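/- **Conventions.** A structure has a non-empty universe. A vocabulary may contain relation, function and constant symbols. A *logic* $L$ assigns to every vocabulary $\tau$ a collection of $L[\tau]$-sentences, with a truth relation between $L[\tau]$-sentences and $\tau$-structures. It is an *abstract logic* (closure under negation is not required) if truth is invariant under isomorphism and sentences are closed under conjunction, renaming of symbols, and free expansion of the vocabulary. A *positive logic* is an abstract logic that contains first order logic and is closed under $\wedge,\vee$ and the first order quantifiers $\exists,\forall$. We write $L\le L'$ ($L'$ contains, or extends, $L$) if every $L[\tau]$-sentence is equivalent to an $L'[\tau]$-sentence, for every $\tau$. The extension is proper if $L'\not\le L$. The *Compactness Theorem* for $L$: a countable theory has a model if each of its finite subsets has one; the *full* Compactness Theorem says this for theories of every cardinality. The *Downward Löwenheim–Skolem Theorem* for $L$: every $L$-sentence in a countable vocabulary that has a model has a countable model. $\Sigma^1_1$ (respectively $\Sigma^1_{1,\delta}$) consists of the sentences $\exists R_1\cdots\exists R_m\,\varphi$ with relation variables $R_i$ of any arities and $\varphi$ a first order sentence (respectively a countable conjunction of first order sentences). **The quantifiers.** Let $\mathcal N=(N,R_0,R_1,R_2,R_3,R_4)$ with $R_0,R_1,R_2$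 binary and $R_3,R_4$ unary. An element $a$ represents $\eta\in 2^n$ if $R_4(a)$ and there are $y_0,\dots,y_n$ with $R_3(y_0)$, $R_4(y_i)$ and $y_iR_2a$ for $i\le n$, and $y_iR_{\eta(i)}y_{i+1}$ for $i<n$. Let $\Omega(\mathcal N)$ be the set of $\eta\in 2^\omega$ such that a single element represents all $\eta\restriction n$, $n<\omega$. Call $\mathcal N$ *tree-like* if: some element of $R_3$ is $R_2$-below every element of $R_4$, and $R_3$ has only one element; $R_0,R_1\subseteq R_2\subseteq R_4\times R_4$; $R_2$ is a reflexive, transitive and antisymmetric relation on $R_4$; any two $R_2$-predecessors of an element are $R_2$-comparable; $R_0$ and $R_1$ are partial functions; and if $xR_0y$ and $xR_1z$, then $y$ and $z$ are not $R_2$-comparable. (It follows that one element represents all initial segments of at most one $\eta\in2^\omega$.) Let $\mathcal A$ be a family of subsets of $2^\omega$ with a largest member $A^*$. The formula $Q_{\mathcal A}x_0x_1(\psi_0,\psi_1,\psi_2,\psi_3,\psi_4)$ is true in $\mathcal M$ at parameters $\bar c$ if the structure $\mathcal M_{\bar\psi}$ on the universe of $\mathcal M$ whose relations are defined by $\psi_0(x_0,x_1,\bar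 c),\psi_1(x_0,x_1,\bar c),\psi_2(x_0,x_1,\bar c),\psi_3(x_0,\bar c),\psi_4(x_0,\bar c)$ is tree-like and $\Omega(\mathcal M_{\bar\psi})\cap A^*\in\mathcal A$. Let $L^{d^-}_{\mathcal A}$ be the closure of first order logic under $\wedge,\vee,\exists,\forall$, existential quantification $\exists R$ over relations, and $Q_{\mathcal A}$ applied to first order formulas only; $L^{d^-,\omega}_{\mathcal A}$ also allows countable conjunctions. **Theorem.** There are disjoint stationary sets $S,S'\subseteq\omega_1$, and there are sequences $\langle A_\alpha:\alpha<\omega_1\rangle$ of countable dense subsets of $2^\omega$ that are strictly increasing and continuous ($A_\alpha=\bigcup_{\beta<\alpha}A_\beta$ for limit $\alpha$). For all such $S,S'$ and $\langle A_\alpha\rangle$, put $A_{\omega_1}=\bigcup_{\alpha<\omega_1}A_\alpha$, $\mathcal A=\{A_\alpha:\alpha\in S\}\cup\{A_{\omega_1}\}$ and $\mathcal A'=\{A_\alpha:\alpha\in S'\}\cup\{A_{\omega_1}\}$. Then $L_1=L^{d^-}_{\mathcal A}$ and $L_2=L^{d^-}_{\mathcal A'}$ are positive logics such that 1. $L_1$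 and $L_2$ both properly extend $\Sigma^1_1$; 2. $L_1$ and $L_2$ both satisfy the (full) Compactness Theorem and the Downward Löwenheim–Skolem Theorem; 3. there is no abstract logic $L_3$ with $L_1\le L_3$ and $L_2\le L_3$ that satisfies the Downward Löwenheim–Skolem Theorem. The same holds for $L_1=L^{d^-,\omega}_{\mathcal A}$ and $L_2=L^{d^-,\omega}_{\mathcal A'}$ with $\Sigma^1_{1,\delta}$ in place of $\Sigma^1_1$. **Corollary.** Let $B$ be first order logic, $\Sigma^1_1$, or $\Sigma^1_{1,\delta}$. Among the positive logics that extend $B$ and satisfy the Compactness Theorem and the Downward Löwenheim–Skolem Theorem there is no strongest one, i.e. none that contains all the others. In particular, no extension of $\Sigma^1_1$ is strongest among the positive logics with these two properties. -/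

import Mathlib

open FirstOrder
open scoped Ordinal Cardinal

universe u v w

/-! ## Abstract logics and positive logics

Vocabularies are Mathlib's first-order languages, and a model for a vocabulary `τ` is a non-empty
`τ`-structure: every definition below that quantifies over models asks for `[Nonempty M]`. -/

/-- The data of a logic: for each vocabulary `τ` its `τ`-sentences, and the truth relation between
`τ`-sentences and `τ`-structures. -/
structure Logic where
  Sentence : FirstOrder.Language.{u, u} → Type v
  Sat : ∀ {τ : FirstOrder.Language.{u, u}}, Sentence τ → ∀ (M : Type u) [τ.Structure M], Prop

namespace Logic

/-- The expansion of a `τ`-structure on `M` by one new constant symbol, which denotes `a`. -/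
@[reducible]
def expandConstant (τ : FirstOrder.Language.{u, u}) (M : Type u) [τ.Structure M] (a : M) :
    (τ.withConstants PUnit.{u + 1}).Structure M :=
  letI : (FirstOrder.Language.constantsOn PUnit.{u + 1}).Structure M :=
    FirstOrder.Language.constantsOn.structure (fun _ => a)
  inferInstance

/-- Abstract logics, no closure under negation being required: truth is invariant under
isomorphism, and sentences are closed under conjunction and under renaming of symbols and free
expansion (along an injective map of vocabularies). -/
structure IsAbstract (L : Logic.{u, v}) : Prop where
  iso : ∀ {τ : FirstOrder.Language.{u, u}} (φ : L.Sentence τ) (M N : Type u) [Nonempty M]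
    [Nonempty N] [τ.Structure M] [τ.Structure N], Nonempty (M ≃[τ] N) → L.Sat φ M → L.Sat φ N
  conj : ∀ {τ : FirstOrder.Language.{u, u}} (φ ψ : L.Sentence τ), ∃ χ : L.Sentence τ,
    ∀ (M : Type u) [Nonempty M] [τ.Structure M], L.Sat χ M ↔ (L.Sat φ M ∧ L.Sat ψ M)
  rename : ∀ {τ τ' : FirstOrder.Language.{u, u}} (f : τ →ᴸ τ'), f.Injective → ∀ φ : L.Sentence τ,
    ∃ ψ : L.Sentence τ', ∀ (M : Type u) [Nonempty M] [τ'.Structure M],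
      L.Sat ψ M ↔ @Sat L τ φ M (f.reduct M)

/-- `L.Sublogic L'`, also written `L ≤ L'`: every sentence of `L` is equivalent to a sentence of
`L'` of the same vocabulary. In other words, `L'` extends (or contains) `L`. -/
def Sublogic (L : Logic.{u, v}) (L' : Logic.{u, w}) : Prop :=
  ∀ {τ : FirstOrder.Language.{u, u}} (φ : L.Sentence τ), ∃ ψ : L'.Sentence τ,
    ∀ (M : Type u) [Nonempty M] [τ.Structure M], L.Sat φ M ↔ L'.Sat ψ M

/-- `L'` extends `L` properly. -/
def ProperSublogic (L : Logic.{u, v}) (L' : Logic.{u, w}) : Prop :=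
  L.Sublogic L' ∧ ¬ L'.Sublogic L

/-- First order logic. -/
def firstOrder : Logic.{u, u} where
  Sentence τ := τ.Sentence
  Sat φ M _ := M ⊨ φ

/-- Positive logics: abstract logics that contain first order logic and are closed under
disjunction, conjunction, and the first order quantifiers. Closure under the quantifiers is
expressed by a new constant symbol in the role of the quantified variable. -/
structure IsPositive (L : Logic.{u, v}) : Prop extends L.IsAbstract where
  firstOrder_le : firstOrder.Sublogic L
  disj : ∀ {τ : FirstOrder.Language.{u, u}} (φ ψ : L.Sentence τ), ∃ χ : L.Sentence τ,
    ∀ (M : Type u) [Nonempty M] [τ.Structure M], L.Sat χ M ↔ (L.Sat φ M ∨ L.Sat ψ M)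
  ex : ∀ {τ : FirstOrder.Language.{u, u}} (φ : L.Sentence (τ.withConstants PUnit.{u + 1})),
    ∃ χ : L.Sentence τ, ∀ (M : Type u) [Nonempty M] [τ.Structure M],
      L.Sat χ M ↔ ∃ a : M, @Sat L _ φ M (expandConstant τ M a)
  all : ∀ {τ : FirstOrder.Language.{u, u}} (φ : L.Sentence (τ.withConstants PUnit.{u + 1})),
    ∃ χ : L.Sentence τ, ∀ (M : Type u) [Nonempty M] [τ.Structure M],
      L.Sat χ M ↔ ∀ a : M, @Sat L _ φ M (expandConstant τ M a)

/-- The set `T` of sentences has a model. -/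
def HasModel (L : Logic.{u, v}) {τ : FirstOrder.Language.{u, u}} (T : Set (L.Sentence τ)) : Prop :=
  ∃ (M : Type u) (_ : Nonempty M) (_ : τ.Structure M), ∀ φ ∈ T, L.Sat φ M

/-- The `(κ, μ)`-Compactness Theorem: if every subset of size `< μ` of a theory of size `≤ κ` has a
model, then the theory has a model. -/
def Compact (L : Logic.{u, v}) (κ μ : Cardinal.{v}) : Prop :=
  ∀ {τ : FirstOrder.Language.{u, u}} (T : Set (L.Sentence τ)), #T ≤ κ →
    (∀ T₀ ⊆ T, #T₀ < μ → L.HasModel T₀) → L.HasModel T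

/-- The Compactness Theorem, for countable theories. -/
def CompactnessTheorem (L : Logic.{u, v}) : Prop := L.Compact ℵ₀ ℵ₀

/-- The full Compactness Theorem, for theories of every size. -/
def FullCompactnessTheorem (L : Logic.{u, v}) : Prop := ∀ κ : Cardinal.{v}, L.Compact κ ℵ₀

/-- The Downward Löwenheim–Skolem Theorem: every sentence in a countable vocabulary that has a
model has a countable model. -/
def DownwardLowenheimSkolem (L : Logic.{u, v}) : Prop :=
  ∀ {τ : FirstOrder.Language.{u, u}}, τ.card ≤ ℵ₀ → ∀ φ : L.Sentence τ,
    (∃ (M : Type u) (_ : Nonempty M) (_ : τ.Structure M), L.Sat φ M) →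
    ∃ (M : Type u) (_ : Nonempty M) (_ : τ.Structure M), Countable M ∧ L.Sat φ M

/-- `L` is strongest, with respect to the Compactness Theorem and the Downward Löwenheim–Skolem
Theorem, among the positive logics that extend `B`: it is such a logic itself, and it contains
every other such logic. (The sentences of `L` may live in any universe; containment is demanded
only for competitors whose sentences form small types.) -/
structure IsStrongestExtension (B : Logic.{u, u}) (L : Logic.{u, v}) : Prop where
  positive : L.IsPositive
  le : B.Sublogic L
  compact : L.CompactnessTheorem
  lowenheimSkolem : L.DownwardLowenheimSkolem
  strongest : ∀ L' : Logic.{u, u}, L'.IsPositive → B.Sublogic L' → L'.CompactnessTheorem →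
    L'.DownwardLowenheimSkolem → L'.Sublogic L

end Logic

/-! ## Relation variables -/

/-- The relation variables of arity `k` in a context, a context being the list of the arities of
the relation variables that are available. -/
inductive RelVar : List ℕ → ℕ → Type
  | head {k : ℕ} {Γ : List ℕ} : RelVar (k :: Γ) k
  | tail {k m : ℕ} {Γ : List ℕ} : RelVar Γ k → RelVar (m :: Γ) k

/-- The vocabulary that consists of the relation variables in a context. -/
def relVarLanguage (Γ : List ℕ) : FirstOrder.Language.{0, 0} where
  Functions _ := Empty
  Relations k := RelVar Γ k

/-- The vocabulary `τ` together with the relation variables in the context `Γ`. -/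
abbrev withRelVars (τ : FirstOrder.Language.{u, u}) (Γ : List ℕ) : FirstOrder.Language.{u, u} :=
  τ.sum (relVarLanguage Γ)

/-- An assignment of relations on `M` to the relation variables in the context `Γ`. -/
def RelAssignment (Γ : List ℕ) (M : Type u) : Type u :=
  ∀ ⦃k : ℕ⦄, RelVar Γ k → (Fin k → M) → Prop

/-- The assignment on the empty context. -/
def RelAssignment.empty (M : Type u) : RelAssignment [] M := fun _ r => nomatch r

/-- Extend an assignment by a value `R` of one more relation variable. -/
def RelAssignment.cons {Γ : List ℕ} {M : Type u} {k : ℕ} (R : (Fin k → M) → Prop)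
    (ρ : RelAssignment Γ M) : RelAssignment (k :: Γ) M
  | _, .head => R
  | _, .tail r => ρ r

/-- The expansion of a `τ`-structure by the relations of an assignment. -/
@[reducible]
def RelAssignment.expand (τ : FirstOrder.Language.{u, u}) {M : Type u} [τ.Structure M] {Γ : List ℕ}
    (ρ : RelAssignment Γ M) : (withRelVars τ Γ).Structure M :=
  letI : (relVarLanguage Γ).Structure M :=
    { funMap := fun f _ => nomatch f
      RelMap := fun r xs => ρ r xs }
  inferInstance

/-- Truth of a first order formula with relation variables and free variables `x₀, …, xₙ₋₁`. -/
def RelAssignment.Holds {τ : FirstOrder.Language.{u, u}} {M : Type u} [τ.Structure M]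
    {Γ : List ℕ} {n : ℕ} (ρ : RelAssignment Γ M) (φ : (withRelVars τ Γ).BoundedFormula Empty n)
    (xs : Fin n → M) : Prop :=
  letI := ρ.expand τ
  φ.Realize default xs

namespace Logic

/-- `Σ¹₁`: a string of existential second order quantifiers, with arities `Γ`, followed by a first
order sentence. -/
def sigma11 : Logic.{u, u} where
  Sentence τ := (Γ : List ℕ) × (withRelVars τ Γ).Sentence
  Sat φ M _ := ∃ ρ : RelAssignment φ.1 M, ρ.Holds φ.2 default

/-- `Σ¹₁,δ`: a string of existential second order quantifiers, with arities `Γ`, followed by a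
countable conjunction of first order sentences. -/
def sigma11Delta : Logic.{u, u} where
  Sentence τ := (Γ : List ℕ) × (ℕ → (withRelVars τ Γ).Sentence)
  Sat φ M _ := ∃ ρ : RelAssignment φ.1 M, ∀ i, ρ.Holds (φ.2 i) default

end Logic

/-! ## The quantifiers -/

/-- A structure with binary relations `R₀, R₁, R₂` and unary relations `R₃, R₄`. -/
structure TreeStructure (M : Type u) where
  R₀ : M → M → Prop
  R₁ : M → M → Prop
  R₂ : M → M → Prop
  R₃ : M → Prop
  R₄ : M → Prop

namespace TreeStructure

variable {M : Type u} (N : TreeStructure M)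

/-- The relation `R_b` for a bit `b`, where `false` stands for `0` and `true` for `1`. -/
def bit : Bool → M → M → Prop
  | false => N.R₀
  | true => N.R₁

/-- The element `a` represents the finite sequence `η ↾ n`: there is a path `y₀, …, yₙ` that
starts in `R₃`, follows the bits of `η ↾ n`, and lies in `R₄` and `R₂`-below `a ∈ R₄`. (Only
`y 0, …, y n` and the first `n` bits of `η` matter.) -/
def RepresentsUpTo (a : M) (η : ℕ → Bool) (n : ℕ) : Prop :=
  N.R₄ a ∧ ∃ y : ℕ → M, N.R₃ (y 0) ∧ (∀ i ≤ n, N.R₄ (y i)) ∧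
    (∀ i < n, N.bit (η i) (y i) (y (i + 1))) ∧ ∀ i ≤ n, N.R₂ (y i) a

/-- The set `Ω(N)` of all `η ∈ 2^ω` all of whose finite initial segments are represented by one
and the same element. -/
def Omega : Set (ℕ → Bool) :=
  {η | ∃ a : M, ∀ n : ℕ, N.RepresentsUpTo a η n}

/-- The first order condition that `R₂` is a tree-like partial order on `R₄` with a root in `R₃`,
extending the partial functions `R₀` and `R₁`, whose values at one point are `R₂`-incomparable.
It makes sure that one element represents at most one `η ∈ 2^ω`. -/
structure IsTreeLike : Prop where
  root : ∃ x, N.R₃ x ∧ ∀ y, N.R₄ y → N.R₂ x y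
  root_unique : ∀ x y, N.R₃ x → N.R₃ y → x = y
  zero_le : ∀ x y, N.R₀ x y → N.R₂ x y
  one_le : ∀ x y, N.R₁ x y → N.R₂ x y
  field : ∀ x y, N.R₂ x y → N.R₄ x ∧ N.R₄ y
  refl : ∀ x, N.R₄ x → N.R₂ x x
  trans : ∀ x y z, N.R₂ x y → N.R₂ y z → N.R₂ x z
  antisymm : ∀ x y, N.R₂ x y → N.R₂ y x → x = y
  tree : ∀ x y z, N.R₂ y x → N.R₂ z x → N.R₂ y z ∨ N.R₂ z y
  zero_unique : ∀ x y z, N.R₀ x y → N.R₀ x z → y = z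
  one_unique : ∀ x y z, N.R₁ x y → N.R₁ x z → y = z
  zero_one : ∀ x y z, N.R₀ x y → N.R₁ x z → ¬ N.R₂ y z ∧ ¬ N.R₂ z y

/-- The class of structures that defines the Lindström quantifier `Q_𝒜`, for a family `𝒜` of
subsets of `2^ω` that has a largest member. That largest member is `⋃₀ 𝒜`. -/
def MemQuantifier (𝒜 : Set (Set (ℕ → Bool))) : Prop :=
  N.IsTreeLike ∧ N.Omega ∩ ⋃₀ 𝒜 ∈ 𝒜

end TreeStructure

/-! ## The logics -/

/-- The formulas over the vocabulary `τ` that are built from first order formulas by conjunction,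
disjunction, first order quantifiers, existential second order quantifiers, and the quantifier `Q`
applied to first order formulas only. Countable conjunctions are admitted if `c` is true.
`PosFormula c τ Γ n` consists of the formulas in the relation variables of the context `Γ` and
the free variables `x₀, …, xₙ₋₁`; a first order quantifier binds the last variable `xₙ` of a
formula with `n + 1` free variables, and `Q` binds `xₙ, xₙ₊₁`. -/
inductive PosFormula (c : Prop) (τ : FirstOrder.Language.{u, u}) : List ℕ → ℕ → Type u
  | fo {Γ : List ℕ} {n : ℕ} (φ : (withRelVars τ Γ).BoundedFormula Empty n) : PosFormula c τ Γ n
  | and {Γ : List ℕ} {n : ℕ} (φ ψ : PosFormula c τ Γ n) : PosFormula c τ Γ n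
  | or {Γ : List ℕ} {n : ℕ} (φ ψ : PosFormula c τ Γ n) : PosFormula c τ Γ n
  | ex {Γ : List ℕ} {n : ℕ} (φ : PosFormula c τ Γ (n + 1)) : PosFormula c τ Γ n
  | all {Γ : List ℕ} {n : ℕ} (φ : PosFormula c τ Γ (n + 1)) : PosFormula c τ Γ n
  | exRel {Γ : List ℕ} {n : ℕ} (k : ℕ) (φ : PosFormula c τ (k :: Γ) n) : PosFormula c τ Γ n
  | countableAnd {Γ : List ℕ} {n : ℕ} (h : c) (φ : ℕ → PosFormula c τ Γ n) : PosFormula c τ Γ n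
  | Q {Γ : List ℕ} {n : ℕ} (ψ₀ ψ₁ ψ₂ : (withRelVars τ Γ).BoundedFormula Empty (n + 2))
      (ψ₃ ψ₄ : (withRelVars τ Γ).BoundedFormula Empty (n + 1)) : PosFormula c τ Γ n

/-- Truth of a formula in a `τ`-structure, where `Q` is interpreted as `Q_𝒜`. -/
def PosFormula.Realize (𝒜 : Set (Set (ℕ → Bool))) {c : Prop} {τ : FirstOrder.Language.{u, u}}
    {M : Type u} [τ.Structure M] : ∀ {Γ : List ℕ} {n : ℕ},
      PosFormula c τ Γ n → RelAssignment Γ M → (Fin n → M) → Prop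
  | _, _, .fo φ, ρ, xs => ρ.Holds φ xs
  | _, _, .and φ ψ, ρ, xs => φ.Realize 𝒜 ρ xs ∧ ψ.Realize 𝒜 ρ xs
  | _, _, .or φ ψ, ρ, xs => φ.Realize 𝒜 ρ xs ∨ ψ.Realize 𝒜 ρ xs
  | _, _, .ex φ, ρ, xs => ∃ a : M, φ.Realize 𝒜 ρ (Fin.snoc xs a)
  | _, _, .all φ, ρ, xs => ∀ a : M, φ.Realize 𝒜 ρ (Fin.snoc xs a)
  | _, _, .exRel k φ, ρ, xs => ∃ R : (Fin k → M) → Prop, φ.Realize 𝒜 (ρ.cons R) xs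
  | _, _, .countableAnd _ φ, ρ, xs => ∀ i, (φ i).Realize 𝒜 ρ xs
  | _, _, .Q ψ₀ ψ₁ ψ₂ ψ₃ ψ₄, ρ, xs =>
      TreeStructure.MemQuantifier
        { R₀ := fun a b => ρ.Holds ψ₀ (Fin.snoc (Fin.snoc xs a : Fin _ → M) b)
          R₁ := fun a b => ρ.Holds ψ₁ (Fin.snoc (Fin.snoc xs a : Fin _ → M) b)
          R₂ := fun a b => ρ.Holds ψ₂ (Fin.snoc (Fin.snoc xs a : Fin _ → M) b)
          R₃ := fun a => ρ.Holds ψ₃ (Fin.snoc xs a)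
          R₄ := fun a => ρ.Holds ψ₄ (Fin.snoc xs a) } 𝒜

namespace Logic

/-- The logic `L^{d⁻}_𝒜`. -/
def dMinus (𝒜 : Set (Set (ℕ → Bool))) : Logic.{u, u} where
  Sentence τ := PosFormula False τ [] 0
  Sat φ M _ := φ.Realize 𝒜 (RelAssignment.empty M) default

/-- The logic `L^{d⁻,ω}_𝒜`, in which countable conjunctions are allowed. -/
def dMinusOmega (𝒜 : Set (Set (ℕ → Bool))) : Logic.{u, u} where
  Sentence τ := PosFormula True τ [] 0
  Sat φ M _ := φ.Realize 𝒜 (RelAssignment.empty M) default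

end Logic

/-! ## The families of sets of reals -/

/-- A strictly increasing sequence `⟨A α : α < ω₁⟩` of countable dense subsets of `2^ω` which is
continuous at limit ordinals. -/
structure IsDenseChain (A : Set.Iio (ω₁ : Ordinal.{0}) → Set (ℕ → Bool)) : Prop where
  countable : ∀ α, (A α).Countable
  dense : ∀ α, Dense (A α)
  strictMono : StrictMono A
  continuous : ∀ α, Order.IsSuccLimit α → A α = ⋃ β < α, A β

/-- The family `⟨A α : α ∈ S⟩ ⌢ ⟨A_{ω₁}⟩`, where `A_{ω₁}` is the union of all `A α`. -/
def chainFamily (A : Set.Iio (ω₁ : Ordinal.{0}) → Set (ℕ → Bool))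
    (S : Set (Set.Iio (ω₁ : Ordinal.{0}))) : Set (Set (ℕ → Bool)) :=
  insert (⋃ α, A α) (A '' S)

/-! ## Countable ordinals -/

section CountableOrdinals

open Set Order

/-! In a tree-like structure an element represents at most one real, so a countable structure has a
countable `Omega`. Take the sentence that applies the quantifier to the five basic relations, once
from each logic. The conjunction of the two puts `Ω ∩ A_{ω₁}` into both families. The `A_α` are
distinct and `S`, `S'` are disjoint, so the only common member is the uncountable set `A_{ω₁}`.
Hence the conjunction has a model, a binary tree with enough branches, but no countable one
(`not_exists_common_extension`). Properness follows: if the first logic were contained in the base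
logic, it would be contained in the second one, which would then be a common extension with the
Löwenheim–Skolem property.

Compactness comes from ultraproducts, which preserve all formulas in question from the factors to
the product (`PosFormula.Realize.ultraproduct`). For the quantifier, members of the family are
dense, so each factor represents arbitrarily long initial segments of any given real. If the
ultrafilter lets these lengths tend to infinity, the ultraproduct represents every real, and its
trace on `A_{ω₁}` is the largest member of the family.

For Löwenheim–Skolem, a model `M` is reflected to subsets `N` of the disjoint sum of `M` and `ω₁`.
For almost all `N`, in the sense of a club filter, truth of a formula passes to the `M`-part of `N`,
provided that the ordinals in `N` form an initial segment `δ ∈ S`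
(`PosFormula.Realize.eventually_comap`). If the trace of a tree on `A_{ω₁}` is a countable `A_α`,
then `N` can retain it entirely; if it is `A_{ω₁}`, then continuity of the chain cuts it down to
`A_δ`, again a member of the family. Stationarity of `S` provides a suitable countable `N`
(`IsStationary.exists_of_eventually`). -/

theorem cof_Iio_omega_one_ne : Order.cof (Iio (ω₁ : Ordinal.{0})) ≠ ℵ₀ := by
  rw [Ordinal.cof_Iio, Ordinal.lift_omega, Ordinal.lift_one, Cardinal.cof_omega_one]
  exact Cardinal.aleph0_lt_aleph_one.ne'

instance : Nonempty (Iio (ω₁ : Ordinal.{0})) := ⟨⟨0, Ordinal.omega_pos 1⟩⟩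

theorem countable_Iio_of_lt_omega_one (δ : Iio (ω₁ : Ordinal.{0})) : (Iio δ).Countable := by
  have h : (Iio δ.1).Countable := by
    rw [← Cardinal.le_aleph0_iff_set_countable, Cardinal.mk_Iio_ordinal, Cardinal.lift_le_aleph0,
      ← Order.lt_succ_iff, Cardinal.succ_aleph0, ← Cardinal.lt_ord, Cardinal.ord_aleph]
    exact δ.2
  exact (h.preimage Subtype.val_injective).mono fun x hx => hx

theorem exists_forall_lt_of_countable {s : Set (Iio (ω₁ : Ordinal.{0}))} (hs : s.Countable) :
    ∃ β, ∀ α ∈ s, α < β := by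
  have := hs.to_subtype
  have hlim : IsSuccLimit (ω₁ : Ordinal.{0}) := Cardinal.isSuccLimit_omega 1
  have h := Ordinal.iSup_lt_omega_one (f := fun i : s => Order.succ i.1.1)
    fun i => hlim.succ_lt i.1.2
  refine ⟨⟨_, h⟩, fun α hα => Subtype.coe_lt_coe.1 ?_⟩
  have : Order.succ α.1 ≤ ⨆ i : s, Order.succ i.1.1 :=
    le_ciSup (f := fun i : s => Order.succ i.1.1) (Ordinal.bddAbove_of_small) ⟨α, hα⟩
  exact Order.succ_le_iff.1 this

theorem exists_isLUB_of_countable {s : Set (Iio (ω₁ : Ordinal.{0}))} (hs : s.Countable) :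
    ∃ δ, IsLUB s δ := by
  obtain ⟨β, hβ⟩ := exists_forall_lt_of_countable hs
  have hne : (upperBounds s).Nonempty := ⟨β, fun α hα => (hβ α hα).le⟩
  exact ⟨_, WellFounded.min_mem wellFounded_lt _ hne,
    fun b hb => WellFounded.min_le wellFounded_lt hb⟩

instance : NoMaxOrder (Iio (ω₁ : Ordinal.{0})) :=
  ⟨fun a => (exists_forall_lt_of_countable (countable_singleton a)).imp fun _ h => h a rfl⟩

theorem exists_injective_cantor :
    ∃ r : Iio (ω₁ : Ordinal.{0}) → (ℕ → Bool), Function.Injective r := by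
  have h : Cardinal.lift.{0} #(Iio (ω₁ : Ordinal.{0})) ≤ Cardinal.lift.{1} #(ℕ → Bool) := by
    simp only [Cardinal.mk_Iio_ordinal, Ordinal.card_omega, Cardinal.lift_aleph, Cardinal.mk_pi,
      Cardinal.mk_bool, Cardinal.prod_const, Cardinal.mk_nat, Cardinal.lift_id,
      Cardinal.two_power_aleph0]
    simpa using Cardinal.aleph_one_le_continuum
  exact (Cardinal.lift_mk_le'.1 h).elim fun e => ⟨e, e.injective⟩

/-- Label the countable ordinals by distinct reals. If no two stationary sets were disjoint, every
bit of the label would be constant on a club, and on the intersection of these countably many clubs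
all labels would agree. -/
theorem exists_disjoint_isStationary :
    ∃ S S' : Set (Iio (ω₁ : Ordinal.{0})), IsStationary S ∧ IsStationary S' ∧ Disjoint S S' := by
  by_contra! H
  obtain ⟨r, hr⟩ := exists_injective_cantor
  have h : ∀ n, ∃ b, ∃ t, IsClub t ∧ ∀ α ∈ t, r α n = b := by
    intro n
    by_cases h₀ : IsStationary {α | r α n = true}
    · have h₁ : ¬ IsStationary {α | r α n = false} := fun h₁ =>
        H _ _ h₀ h₁ (Set.disjoint_left.2 fun α h h' => by simp_all)
      obtain ⟨t, ht, hd⟩ := not_isStationary_iff.1 h₁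
      exact ⟨true, t, ht, fun α hα => by
        by_contra hb
        exact Set.disjoint_left.1 hd (by simpa using hb) hα⟩
    · obtain ⟨t, ht, hd⟩ := not_isStationary_iff.1 h₀
      exact ⟨false, t, ht, fun α hα => by
        by_contra hb
        exact Set.disjoint_left.1 hd (by simpa using hb) hα⟩
  choose b t ht hb using h
  have hclub := IsClub.iInter_of_countable cof_Iio_omega_one_ne ht
  obtain ⟨α, hα⟩ := hclub.nonempty
  obtain ⟨α', hα'⟩ := exists_gt α
  obtain ⟨β, hβ, hle⟩ := hclub.isCofinal α'
  refine (hα'.trans_le hle).ne (hr (funext fun n => ?_))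
  rw [hb n α (mem_iInter.1 hα n), hb n β (mem_iInter.1 hβ n)]

theorem exists_isDenseChain : ∃ A : Iio (ω₁ : Ordinal.{0}) → Set (ℕ → Bool), IsDenseChain A := by
  obtain ⟨r, hr⟩ := exists_injective_cantor
  obtain ⟨D, hDc, hD⟩ := TopologicalSpace.exists_countable_dense (ℕ → Bool)
  have hsm : ∃ γ, ∀ α, r α ∈ D → α < γ := by
    obtain ⟨γ, hγ⟩ := exists_forall_lt_of_countable (hDc.preimage hr)
    exact ⟨γ, fun α h => hγ α h⟩
  obtain ⟨γ, hγ⟩ := hsm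
  -- Only countably many labels lie in `D`, all at indices below `γ`; shifting the index by `γ`
  -- avoids them. This makes the chain below strictly increasing.
  have hinj : ∃ r' : Iio (ω₁ : Ordinal.{0}) → (ℕ → Bool),
      Function.Injective r' ∧ ∀ α, r' α ∉ D := by
    have hle : ∀ α : Iio (ω₁ : Ordinal.{0}), ∃ β : Iio (ω₁ : Ordinal.{0}),
        β.1 = γ.1 + α.1 := fun α =>
      ⟨⟨γ.1 + α.1, (Ordinal.isPrincipal_add_omega 1) γ.2 α.2⟩, rfl⟩
    choose g hg using hle
    refine ⟨r ∘ g, hr.comp fun a b hab => ?_, fun α h => ?_⟩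
    · have := congrArg Subtype.val hab
      rw [hg, hg] at this
      exact Subtype.ext (add_left_cancel this)
    · have := hγ _ h
      rw [← Subtype.coe_lt_coe, hg] at this
      exact absurd this (not_lt.2 le_self_add)
  obtain ⟨r', hr', hrD⟩ := hinj
  refine ⟨fun α => D ∪ r' '' Iio α, fun α => hDc.union
    ((countable_Iio_of_lt_omega_one α).image _), fun α => hD.mono subset_union_left, ?_, ?_⟩
  · intro α β h
    refine ⟨union_subset_union_right _ (image_mono (Iio_subset_Iio h.le)), fun hs => ?_⟩
    rcases hs (Or.inr ⟨α, h, rfl⟩) with h' | ⟨x, hx, hxe⟩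
    · exact hrD _ h'
    · exact (hr' hxe ▸ hx : α < α).false
  · intro α hα
    ext x
    simp only [mem_union, mem_image, mem_Iio, mem_iUnion, exists_prop]
    constructor
    · rintro (h | ⟨β, hβ, rfl⟩)
      · obtain ⟨β, hβ⟩ := not_isMin_iff.1 hα.not_isMin
        exact ⟨β, hβ, Or.inl h⟩
      · obtain ⟨δ, hδ, hδ'⟩ := hα.lt_iff_exists_lt.1 hβ
        exact ⟨δ, hδ, Or.inr ⟨β, hδ', rfl⟩⟩
    · rintro ⟨β, hβ, h | ⟨δ, hδ, rfl⟩⟩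
      · exact Or.inl h
      · exact Or.inr ⟨δ, hδ.trans hβ, rfl⟩

/-! ### Families of sets obtained from a dense chain -/

namespace IsDenseChain

variable {A : Iio (ω₁ : Ordinal.{0}) → Set (ℕ → Bool)}

/-- Countably many stages have a common bound, so a countable union would be exhausted at some
stage, against strict growth. -/
theorem not_countable_iUnion (hA : IsDenseChain A) : ¬ (⋃ α, A α).Countable := by
  intro hc
  have h : ∀ η : (⋃ α, A α : Set (ℕ → Bool)), ∃ α, η.1 ∈ A α := fun η => mem_iUnion.1 η.2
  choose f hf using h
  have := hc.to_subtype
  obtain ⟨β, hβ⟩ := exists_forall_lt_of_countable (countable_range f)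
  obtain ⟨γ, hγ⟩ := exists_gt β
  refine (hA.strictMono hγ).2 fun η hη => ?_
  have := hβ _ ⟨⟨η, mem_iUnion.2 ⟨γ, hη⟩⟩, rfl⟩
  exact hA.strictMono.monotone this.le (hf ⟨η, mem_iUnion.2 ⟨γ, hη⟩⟩)

theorem sUnion_chainFamily (S : Set (Iio (ω₁ : Ordinal.{0}))) :
    ⋃₀ chainFamily A S = ⋃ α, A α := by
  apply subset_antisymm
  · rintro η ⟨B, rfl | ⟨α, -, rfl⟩, hη⟩
    · exact hη
    · exact mem_iUnion.2 ⟨α, hη⟩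
  · exact subset_sUnion_of_mem (mem_insert _ _)

theorem dense_of_mem (hA : IsDenseChain A) {S : Set (Iio (ω₁ : Ordinal.{0}))}
    {B : Set (ℕ → Bool)} (hB : B ∈ chainFamily A S) : Dense B := by
  rcases hB with rfl | ⟨α, -, rfl⟩
  · exact (hA.dense (Classical.arbitrary _)).mono (subset_iUnion A _)
  · exact hA.dense α

theorem eq_iUnion_of_mem_of_mem (hA : IsDenseChain A) {S S' : Set (Iio (ω₁ : Ordinal.{0}))}
    (hS : Disjoint S S') {B : Set (ℕ → Bool)} (h : B ∈ chainFamily A S)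
    (h' : B ∈ chainFamily A S') : B = ⋃ α, A α := by
  rcases h with rfl | ⟨α, hα, rfl⟩
  · rfl
  · rcases h' with h' | ⟨β, hβ, hβα⟩
    · exact h'
    · exact absurd (hA.strictMono.injective hβα ▸ hβ) (Set.disjoint_left.1 hS hα)

end IsDenseChain

end CountableOrdinals

/-! ## The filter of closed unbounded collections of subsets -/

section ClubFilter

open Set Filter

/-- The set `N` is closed under the operation `G` on finite subsets. -/
def FinsetClosed {X : Type*} (G : Finset X → Set X) (N : Set X) : Prop :=
  ∀ s : Finset X, ↑s ⊆ N → G s ⊆ N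

/-- The filter on the subsets of `X` that is generated by the collections of all sets closed under
an operation that maps finite sets to countable sets. -/
def clubFilter (X : Type*) : Filter (Set X) :=
  Filter.ofCountableInter
    {𝒞 | ∃ G : Finset X → Set X, (∀ s, (G s).Countable) ∧ ∀ N, FinsetClosed G N → N ∈ 𝒞}
    (by
      intro T hT h
      choose G hG hN using fun 𝒞 (h𝒞 : 𝒞 ∈ T) => h h𝒞
      refine ⟨fun s => ⋃ 𝒞, ⋃ h : 𝒞 ∈ T, G 𝒞 h s, fun s => hT.biUnion fun 𝒞 h => hG 𝒞 h s,
        fun N h 𝒞 h𝒞 => hN 𝒞 h𝒞 N fun s hs => ?_⟩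
      exact (subset_iUnion₂ (s := fun 𝒞 h => G 𝒞 h s) 𝒞 h𝒞).trans (h s hs))
    (by
      rintro s t ⟨G, hG, hN⟩ hst
      exact ⟨G, hG, fun N h => hst (hN N h)⟩)

instance {X : Type*} : CountableInterFilter (clubFilter X) :=
  inferInstanceAs (CountableInterFilter (Filter.ofCountableInter _ _ _))

variable {X : Type*}

theorem eventually_clubFilter {P : Set X → Prop} : (∀ᶠ N in clubFilter X, P N) ↔
    ∃ G : Finset X → Set X, (∀ s, (G s).Countable) ∧ ∀ N, FinsetClosed G N → P N :=
  Iff.rfl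

theorem eventually_mem_clubFilter (a : X) : ∀ᶠ N in clubFilter X, a ∈ N :=
  eventually_clubFilter.2 ⟨fun _ => {a}, fun _ => countable_singleton a,
    fun _ h => h ∅ (by simp) rfl⟩

/-- Closure under diagonal intersections: a property indexed by elements may be demanded for exactly
those indices that lie in `N`. The map `e` will be the inclusion of one summand of the disjoint sum.
-/
theorem eventually_diagonal {Y : Type*} {e : Y → X} (he : Function.Injective e)
    {P : Y → Set X → Prop} (h : ∀ y, ∀ᶠ N in clubFilter X, P y N) :
    ∀ᶠ N in clubFilter X, ∀ y, e y ∈ N → P y N := by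
  choose G hG hN using fun y => eventually_clubFilter.1 (h y)
  -- The index `y` is coded into the finite set `t`, which then yields all values `G y s` with `s ⊆
  -- t`.
  refine eventually_clubFilter.2 ⟨fun t => ⋃ y ∈ e ⁻¹' t, ⋃ s ∈ t.powerset, G y s,
    fun t => ((t.countable_toSet.preimage he).biUnion fun y _ =>
      t.powerset.countable_toSet.biUnion fun s _ => hG y s), fun N h y hy => ?_⟩
  classical
  refine hN y N fun s hs x hx => h (insert (e y) s) ?_ ?_
  · simp [insert_subset_iff, hy, hs]
  · simp only [mem_iUnion]
    exact ⟨y, by simp, s, by simp, hx⟩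

theorem eventually_diagonal_fin {Y : Type*} {e : Y → X} (he : Function.Injective e) {n : ℕ}
    {P : (Fin n → Y) → Set X → Prop} (h : ∀ y, ∀ᶠ N in clubFilter X, P y N) :
    ∀ᶠ N in clubFilter X, ∀ y : Fin n → Y, (∀ i, e (y i) ∈ N) → P y N := by
  induction n with
  | zero => exact (h default).mono fun N hN y _ => Subsingleton.elim default y ▸ hN
  | succ n ih =>
    have : ∀ a, ∀ᶠ N in clubFilter X, ∀ y : Fin n → Y, (∀ i, e (y i) ∈ N) → P (Fin.cons a y) N :=
      fun a => ih fun y => h _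
    refine (eventually_diagonal he this).mono fun N hN y hy => ?_
    simpa using hN (y 0) (hy 0) (Fin.tail y) fun i => hy i.succ

theorem exists_finsetClosed_hull {G : Finset X → Set X} (hG : ∀ s, (G s).Countable) :
    ∃ H : Set X → Set X, ∀ B, B ⊆ H B ∧ FinsetClosed G (H B) ∧ (B.Countable → (H B).Countable) ∧
      ∀ C, B ⊆ C → FinsetClosed G C → H B ⊆ C := by
  refine ⟨fun B => ⋂₀ {C | B ⊆ C ∧ FinsetClosed G C}, fun B => ⟨?_, ?_, ?_, ?_⟩⟩
  · exact subset_sInter fun C h => h.1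
  · exact fun s hs => subset_sInter fun C h => h.2 s fun x hx => hs hx C h
  · intro hB
    -- Countability is checked on a larger set: the union of `ω` many closure steps is closed,
    -- because a finite subset of it already appears at a finite step.
    let step : Set X → Set X := fun D => D ∪ ⋃ s ∈ {s : Finset X | ↑s ⊆ D}, G s
    have hstep : ∀ D, D.Countable → (step D).Countable := fun D hD => by
      refine hD.union (Set.Countable.biUnion ?_ fun s _ => hG s)
      have := (countable_ofPred_finite_subset hD).preimage (Finset.coe_injective (α := X))
      exact this.mono fun s hs => show (s : Set X).Finite ∧ (s : Set X) ⊆ D from ⟨s.finite_toSet, hs⟩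
    have hc : ∀ n, (step^[n] B).Countable := fun n => by
      induction n with
      | zero => exact hB
      | succ n ih => rw [Function.iterate_succ_apply']; exact hstep _ ih
    refine (countable_iUnion hc).mono (sInter_subset_of_mem ⟨subset_iUnion (fun n => step^[n] B) 0,
      fun s hs => ?_⟩)
    have hm : Monotone fun n => step^[n] B := monotone_nat_of_le_succ fun n => by
      simp only [Function.iterate_succ_apply']
      exact subset_union_left
    obtain ⟨n, hn⟩ := Directed.exists_mem_subset_of_finset_subset_biUnion
        hm.directed_le hs
    refine subset_trans ?_ (subset_iUnion _ (n + 1))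
    rw [Function.iterate_succ_apply']
    exact subset_union_of_subset_right (subset_biUnion_of_mem (u := G) (show s ∈ {s : Finset X |
      (s : Set X) ⊆ step^[n] B} from hn)) _
  · exact fun C hBC hC => sInter_subset_of_mem ⟨hBC, hC⟩

/-- The hulls `K δ` of the ordinals below `δ` form a continuous increasing chain of countable closed
sets. Those `δ` whose hull contains no ordinal beyond `δ` form a club, so one of them belongs to
`S`. -/
theorem IsStationary.exists_of_eventually {S : Set (Iio (ω₁ : Ordinal.{0}))} (hS : IsStationary S)
    {M : Type*} {P : Set (M ⊕ Iio (ω₁ : Ordinal.{0})) → Prop}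
    (h : ∀ᶠ N in clubFilter (M ⊕ Iio (ω₁ : Ordinal.{0})), P N) :
    ∃ N, N.Countable ∧ (∃ δ ∈ S, Sum.inr ⁻¹' N = Iio δ) ∧ P N := by
  obtain ⟨G, hG, hP⟩ := eventually_clubFilter.1 h
  obtain ⟨H, hH⟩ := exists_finsetClosed_hull hG
  let K : Iio (ω₁ : Ordinal.{0}) → Set (M ⊕ Iio (ω₁ : Ordinal.{0})) := fun δ => H (Sum.inr '' Iio δ)
  have hK : Monotone K := fun δ ε hle => (hH _).2.2.2 _
    ((image_mono (Iio_subset_Iio hle)).trans (hH _).1) (hH _).2.1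
  have hcount : ∀ δ, (K δ).Countable := fun δ =>
    (hH _).2.2.1 ((countable_Iio_of_lt_omega_one δ).image _)
  have hcont : ∀ d : Set (Iio (ω₁ : Ordinal.{0})), d.Nonempty → ∀ a, IsLUB d a →
      K a ⊆ ⋃ δ : d, K δ := by
    intro d hd a ha
    have := hd.to_subtype
    refine (hH _).2.2.2 _ ?_ fun s hs => ?_
    · rintro _ ⟨α, hα, rfl⟩
      obtain ⟨δ, hδ, hlt⟩ := (lt_isLUB_iff ha).1 hα
      exact mem_iUnion.2 ⟨⟨δ, hδ⟩, (hH _).1 ⟨α, hlt, rfl⟩⟩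
    · have hm : Monotone fun δ : d => K δ := fun _ _ h => hK h
      obtain ⟨n, hn⟩ := Directed.exists_mem_subset_of_finset_subset_biUnion
        hm.directed_le hs
      exact ((hH _).2.1 s hn).trans (subset_iUnion (fun δ : d => K δ) n)
  let E : Set (Iio (ω₁ : Ordinal.{0})) := {δ | Sum.inr ⁻¹' K δ ⊆ Iio δ}
  have hE : IsClub E := by
    refine ⟨fun d hdE hd _ a ha β hβ => ?_, fun a => ?_⟩
    · obtain ⟨δ, hδ⟩ := mem_iUnion.1 (hcont d hd a ha hβ)
      exact (hdE δ.2 hδ : β < δ.1).trans_le (ha.1 δ.2)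
    · have hf : ∀ α, ∃ γ, α ≤ γ ∧ ∀ β, Sum.inr β ∈ K α → β < γ := fun α => by
        obtain ⟨γ, hγ⟩ := exists_forall_lt_of_countable
          (((hcount α).preimage Sum.inr_injective).insert α)
        exact ⟨γ, (hγ α (mem_insert _ _)).le, fun β hβ => hγ β (mem_insert_of_mem _ hβ)⟩
      choose f hle hf using hf
      obtain ⟨δ, hδ⟩ := exists_isLUB_of_countable (countable_range fun n : ℕ => f^[n] a)
      refine ⟨δ, fun β hβ => ?_, hδ.1 ⟨0, rfl⟩⟩
      obtain ⟨⟨_, n, rfl⟩, hn⟩ := mem_iUnion.1 (hcont _ (range_nonempty _) _ hδ hβ)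
      have := hf _ β hn
      refine this.trans_le (hδ.1 ⟨n + 1, ?_⟩)
      simp only [Function.iterate_succ_apply']
  obtain ⟨δ, hδS, hδ⟩ := hS hE
  exact ⟨K δ, hcount δ, ⟨δ, hδS, Subset.antisymm hδ fun β hβ => (hH _).1 (mem_image_of_mem _ hβ)⟩, hP _ (hH _).2.1⟩

end ClubFilter
/-! ## Tree-like structures -/

namespace TreeStructure

variable {M : Type u} {N : TreeStructure M}

theorem RepresentsUpTo.congr {a : M} {η θ : ℕ → Bool} {n : ℕ} (h : N.RepresentsUpTo a η n)
    (hηθ : ∀ i < n, η i = θ i) : N.RepresentsUpTo a θ n := by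
  obtain ⟨ha, y, h₀, h₁, h₂, h₃⟩ := h
  exact ⟨ha, y, h₀, h₁, fun i hi => hηθ i hi ▸ h₂ i hi, h₃⟩

namespace IsTreeLike

theorem bit_unique (hN : N.IsTreeLike) {b : Bool} {x y z : M} (hy : N.bit b x y)
    (hz : N.bit b x z) : y = z := by
  cases b
  · exact hN.zero_unique x y z hy hz
  · exact hN.one_unique x y z hy hz

/-- Two elements below `a` are comparable, whereas a `0`-successor and a `1`-successor of the same
element are not. -/
theorem eq_of_bit (hN : N.IsTreeLike) {a x y z : M} {b c : Bool} (hy : N.bit b x y)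
    (hz : N.bit c x z) (hya : N.R₂ y a) (hza : N.R₂ z a) : b = c := by
  cases b <;> cases c <;> first | rfl | skip
  · have := hN.zero_one x y z hy hz
    have := hN.tree a y z hya hza
    tauto
  · have := hN.zero_one x z y hz hy
    have := hN.tree a y z hya hza
    tauto

/-- Paths below a common element cannot branch: by induction they coincide, starting at the unique
root. -/
theorem representsUpTo_unique (hN : N.IsTreeLike) {a : M} {η θ : ℕ → Bool}
    (hη : ∀ n, N.RepresentsUpTo a η n) (hθ : ∀ n, N.RepresentsUpTo a θ n) : η = θ := by
  have key : ∀ (n : ℕ) (y z : ℕ → M), N.R₃ (y 0) → N.R₃ (z 0) →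
      (∀ i < n, N.bit (η i) (y i) (y (i + 1))) → (∀ i < n, N.bit (θ i) (z i) (z (i + 1))) →
      (∀ i ≤ n, N.R₂ (y i) a) → (∀ i ≤ n, N.R₂ (z i) a) →
      y n = z n ∧ ∀ i < n, η i = θ i := by
    intro n y z hy₀ hz₀ hy hz hya hza
    induction n with
    | zero => exact ⟨hN.root_unique _ _ hy₀ hz₀, by simp⟩
    | succ n ih =>
      obtain ⟨he, h⟩ := ih (fun i hi => hy i (by omega)) (fun i hi => hz i (by omega))
        (fun i hi => hya i (by omega)) (fun i hi => hza i (by omega))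
      have h₁ := hy n (by omega)
      have h₂ := hz n (by omega)
      rw [← he] at h₂
      have hb := hN.eq_of_bit h₁ h₂ (hya _ le_rfl) (hza _ le_rfl)
      refine ⟨hN.bit_unique h₁ (hb ▸ h₂), fun i hi => ?_⟩
      rcases Nat.lt_succ_iff_lt_or_eq.1 hi with h' | rfl
      · exact h i h'
      · exact hb
  funext n
  obtain ⟨-, y, hy₀, -, hy, hya⟩ := hη (n + 1)
  obtain ⟨-, z, hz₀, -, hz, hza⟩ := hθ (n + 1)
  exact (key (n + 1) y z hy₀ hz₀ hy hz hya hza).2 n n.lt_succ_self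

theorem countable_omega [Countable M] (hN : N.IsTreeLike) : N.Omega.Countable := by
  choose f hf using fun η : N.Omega => η.2
  have : Function.Injective f := fun η θ h =>
    Subtype.ext (hN.representsUpTo_unique (hf η) (h ▸ hf θ))
  exact Set.countable_coe_iff.1 this.countable

end IsTreeLike

/-- The nodes of the full binary tree, together with all its branches. -/
abbrev BinaryTree := List Bool ⊕ (ℕ → Bool)

/-- The finite sequences that are an initial segment of a node or branch. -/
def initialSegments : BinaryTree → Set (List Bool)
  | .inl s => {t | t <+: s}
  | .inr η => {t | t = (List.range t.length).map η}

/-- The binary tree with the branches in `X`. -/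
def ofBranches (X : Set (ℕ → Bool)) : TreeStructure (ULift.{u} BinaryTree) where
  R₀ x y := ∃ s, x.down = .inl s ∧ y.down = .inl (s ++ [false])
  R₁ x y := ∃ s, x.down = .inl s ∧ y.down = .inl (s ++ [true])
  R₂ x y := (∀ η, y.down = .inr η → η ∈ X) ∧
    (x = y ∨ ∃ s, x.down = .inl s ∧ s ∈ initialSegments y.down)
  R₃ x := x.down = .inl []
  R₄ x := ∀ η, x.down = .inr η → η ∈ X

theorem initialSegments_of_prefix {s t : List Bool} {x : BinaryTree} (hs : s <+: t)
    (ht : t ∈ initialSegments x) : s ∈ initialSegments x := by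
  cases x with
  | inl r => exact hs.trans ht
  | inr η =>
    have h := ht
    simp only [initialSegments, Set.mem_ofPred_eq] at h ⊢
    obtain ⟨r, rfl⟩ := hs
    rw [List.length_append, List.range_add, List.map_append] at h
    exact (List.append_inj h (by simp)).1

theorem prefix_or_prefix {s t : List Bool} {x : BinaryTree} (hs : s ∈ initialSegments x)
    (ht : t ∈ initialSegments x) : s <+: t ∨ t <+: s := by
  cases x with
  | inl r => exact List.prefix_or_prefix_of_prefix hs ht
  | inr η =>
    simp only [initialSegments, Set.mem_ofPred_eq] at hs ht
    rw [hs, ht]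
    have key : ∀ m n : ℕ, m ≤ n → (List.range m).map η <+: (List.range n).map η := by
      intro m n h
      obtain ⟨k, rfl⟩ := Nat.exists_eq_add_of_le h
      rw [List.range_add, List.map_append]
      exact List.prefix_append _ _
    exact (le_total s.length t.length).imp (key _ _) (key _ _)

theorem isTreeLike_ofBranches (X : Set (ℕ → Bool)) : (ofBranches.{u} X).IsTreeLike where
  root := ⟨⟨.inl []⟩, rfl, fun ⟨y⟩ hy => ⟨hy, Or.inr ⟨[], rfl, by
    cases y <;> simp [initialSegments]⟩⟩⟩
  root_unique := by
    rintro ⟨x⟩ ⟨y⟩ hx hy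
    exact congrArg _ ((show x = _ from hx).trans (show y = _ from hy).symm)
  zero_le := by
    rintro ⟨x⟩ ⟨y⟩ ⟨s, rfl, rfl⟩
    exact ⟨by simp, Or.inr ⟨s, rfl, List.prefix_append _ _⟩⟩
  one_le := by
    rintro ⟨x⟩ ⟨y⟩ ⟨s, rfl, rfl⟩
    exact ⟨by simp, Or.inr ⟨s, rfl, List.prefix_append _ _⟩⟩
  field := by
    rintro x y ⟨hy, rfl | ⟨s, hs, -⟩⟩
    · exact ⟨hy, hy⟩
    · exact ⟨fun η h => by simp [hs] at h, hy⟩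
  refl x hx := ⟨hx, Or.inl rfl⟩
  trans := by
    rintro x y z ⟨hy, hxy⟩ ⟨hz, rfl | ⟨t, ht, htz⟩⟩
    · exact ⟨hz, hxy⟩
    · rcases hxy with rfl | ⟨s, hs, hst⟩
      · exact ⟨hz, Or.inr ⟨t, ht, htz⟩⟩
      · rw [ht] at hst
        exact ⟨hz, Or.inr ⟨s, hs, initialSegments_of_prefix hst htz⟩⟩
  antisymm := by
    rintro ⟨x⟩ ⟨y⟩ ⟨-, h | ⟨s, hs, hsy⟩⟩ ⟨-, h' | ⟨t, ht, htx⟩⟩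
    · exact h
    · exact h
    · exact h'.symm
    · obtain rfl : x = _ := hs
      obtain rfl : y = _ := ht
      have : s = t := List.IsPrefix.eq_of_length hsy
        (le_antisymm (List.IsPrefix.length_le hsy) (List.IsPrefix.length_le htx))
      rw [this]
  tree := by
    rintro x y z ⟨hx, rfl | ⟨s, hs, hsx⟩⟩ ⟨-, rfl | ⟨t, ht, htx⟩⟩
    · exact Or.inl ⟨hx, Or.inl rfl⟩
    · exact Or.inr ⟨hx, Or.inr ⟨t, ht, htx⟩⟩
    · exact Or.inl ⟨hx, Or.inr ⟨s, hs, hsx⟩⟩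
    · rcases prefix_or_prefix hsx htx with h | h
      · exact Or.inl ⟨fun η h => by simp [ht] at h, Or.inr ⟨s, hs, by rw [ht]; exact h⟩⟩
      · exact Or.inr ⟨fun η h => by simp [hs] at h, Or.inr ⟨t, ht, by rw [hs]; exact h⟩⟩
  zero_unique := by
    rintro ⟨x⟩ ⟨y⟩ ⟨z⟩ ⟨s, rfl, rfl⟩ ⟨t, ht, rfl⟩
    cases ht
    rfl
  one_unique := by
    rintro ⟨x⟩ ⟨y⟩ ⟨z⟩ ⟨s, rfl, rfl⟩ ⟨t, ht, rfl⟩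
    cases ht
    rfl
  zero_one := by
    rintro ⟨x⟩ ⟨y⟩ ⟨z⟩ ⟨s, rfl, rfl⟩ ⟨t, ht, rfl⟩
    cases ht
    constructor
    · rintro ⟨-, h | ⟨r, hr, h⟩⟩
      · simp at h
      · cases hr
        have := List.IsPrefix.eq_of_length h (by simp)
        simp at this
    · rintro ⟨-, h | ⟨r, hr, h⟩⟩
      · simp at h
      · cases hr
        have := List.IsPrefix.eq_of_length h (by simp)
        simp at this

/-- The branch `η` itself is the representing element. The reverse inclusion is not needed, because
`Omega` only matters through its intersection with the largest set of the family. -/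
theorem subset_omega_ofBranches (X : Set (ℕ → Bool)) : X ⊆ (ofBranches.{u} X).Omega := by
  intro η hη
  refine ⟨⟨.inr η⟩, fun n => ⟨?_, fun i => ⟨.inl ((List.range i).map η)⟩, rfl, ?_, ?_, ?_⟩⟩
  · rintro _ ⟨⟩
    exact hη
  · rintro i - η h
    cases h
  · intro i hi
    cases h : η i
    · exact ⟨_, rfl, by simp [List.range_succ, h]⟩
    · exact ⟨_, rfl, by simp [List.range_succ, h]⟩
  · intro i hi
    refine ⟨?_, Or.inr ⟨_, rfl, ?_⟩⟩
    · rintro _ ⟨⟩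
      exact hη
    · simp [initialSegments]

end TreeStructure
/-! ## Pulling back trees and assignments along maps -/

namespace TreeStructure

variable {M K : Type u}

/-- The pullback of a tree structure along a map. -/
def comap (f : K → M) (T : TreeStructure M) : TreeStructure K where
  R₀ x y := T.R₀ (f x) (f y)
  R₁ x y := T.R₁ (f x) (f y)
  R₂ x y := T.R₂ (f x) (f y)
  R₃ x := T.R₃ (f x)
  R₄ x := T.R₄ (f x)

/-- The set `B` contains the root, and the successors of its elements. -/
structure ClosedUnderSucc (T : TreeStructure M) (B : Set M) : Prop where
  root : ∀ x, T.R₃ x → x ∈ B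
  succ : ∀ b, ∀ x ∈ B, ∀ y, T.bit b x y → y ∈ B

variable {f : K → M} {T : TreeStructure M}

theorem bit_comap (b : Bool) (x y : K) : (T.comap f).bit b x y ↔ T.bit b (f x) (f y) := by
  cases b <;> rfl

theorem IsTreeLike.comap (hT : T.IsTreeLike) (hf : Function.Injective f)
    (hroot : ∀ x, T.R₃ x → x ∈ Set.range f) : (T.comap f).IsTreeLike where
  root := by
    obtain ⟨x, hx, h⟩ := hT.root
    obtain ⟨k, rfl⟩ := hroot x hx
    exact ⟨k, hx, fun y hy => h _ hy⟩
  root_unique _ _ h h' := hf (hT.root_unique _ _ h h')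
  zero_le _ _ := hT.zero_le _ _
  one_le _ _ := hT.one_le _ _
  field _ _ := hT.field _ _
  refl _ := hT.refl _
  trans _ _ _ := hT.trans _ _ _
  antisymm _ _ h h' := hf (hT.antisymm _ _ h h')
  tree _ _ _ := hT.tree _ _ _
  zero_unique _ _ _ h h' := hf (hT.zero_unique _ _ _ h h')
  one_unique _ _ _ h h' := hf (hT.one_unique _ _ _ h h')
  zero_one _ _ _ := hT.zero_one _ _ _

/-- The path that witnesses representation is determined by its root and its bits, so it stays
inside any set that contains the root and is closed under successors. -/
theorem representsUpTo_comap (h : T.ClosedUnderSucc (Set.range f)) {a : K} {η : ℕ → Bool}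
    {n : ℕ} : (T.comap f).RepresentsUpTo a η n ↔ T.RepresentsUpTo (f a) η n := by
  constructor
  · rintro ⟨ha, y, h₀, h₁, h₂, h₃⟩
    exact ⟨ha, f ∘ y, h₀, h₁, fun i hi => (bit_comap _ _ _).1 (h₂ i hi), h₃⟩
  · rintro ⟨ha, y, h₀, h₁, h₂, h₃⟩
    have hy : ∀ i, i ≤ n → y i ∈ Set.range f := by
      intro i
      induction i with
      | zero => exact fun _ => h.root _ h₀
      | succ i ih => exact fun hi => h.succ _ _ (ih (by omega)) _ (h₂ i hi)
    have : Nonempty K := ⟨a⟩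
    choose! z hz using hy
    refine ⟨ha, z, ?_, fun i hi => ?_, fun i hi => ?_, fun i hi => ?_⟩
    · exact (congrArg T.R₃ (hz 0 n.zero_le)).mpr h₀
    · exact (congrArg T.R₄ (hz i hi)).mpr (h₁ i hi)
    · rw [bit_comap, hz i hi.le, hz (i + 1) hi]
      exact h₂ i hi
    · exact (congrArg (T.R₂ · (f a)) (hz i hi)).mpr (h₃ i hi)

theorem omega_comap (h : T.ClosedUnderSucc (Set.range f)) :
    (T.comap f).Omega = {η | ∃ a ∈ Set.range f, ∀ n, T.RepresentsUpTo a η n} := by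
  ext η
  simp only [Omega, Set.mem_ofPred_eq, representsUpTo_comap h, Set.exists_range_iff]

theorem MemQuantifier.comap_of_bijective {𝒜 : Set (Set (ℕ → Bool))} (hT : T.MemQuantifier 𝒜)
    (hf : Function.Bijective f) : (T.comap f).MemQuantifier 𝒜 := by
  refine ⟨hT.1.comap hf.1 fun x _ => hf.2 x, ?_⟩
  rw [omega_comap ⟨fun x _ => hf.2 x, fun _ _ _ y _ => hf.2 y⟩]
  simpa [hf.2.range_eq] using! hT.2

end TreeStructure

namespace RelAssignment

variable {M K : Type u} {Γ : List ℕ}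

/-- The pullback of an assignment along a map. -/
def comap (f : K → M) (ρ : RelAssignment Γ M) : RelAssignment Γ K :=
  fun _ r ys => ρ r (f ∘ ys)

theorem eq_empty (ρ : RelAssignment [] M) : ρ = empty M := by
  funext k r
  nomatch r

theorem exists_cons {k : ℕ} (ρ : RelAssignment (k :: Γ) M) :
    ∃ (R : (Fin k → M) → Prop) (σ : RelAssignment Γ M), ρ = σ.cons R := by
  refine ⟨ρ .head, fun _ r => ρ (.tail r), ?_⟩
  funext j r
  cases r <;> rfl

theorem comap_cons (f : K → M) {k : ℕ} (R : (Fin k → M) → Prop) (ρ : RelAssignment Γ M) :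
    (ρ.cons R).comap f = (ρ.comap f).cons fun ys => R (f ∘ ys) := by
  funext j r
  cases r <;> rfl

variable {τ : FirstOrder.Language.{u, u}} [τ.Structure M] [τ.Structure K]

/-- An embedding remains an embedding when the relation variables are pulled back. -/
def comapEmbedding (ρ : RelAssignment Γ M) (f : K ↪[τ] M) :
    letI := ρ.expand τ
    letI := (ρ.comap f).expand τ
    K ↪[withRelVars τ Γ] M :=
  letI := ρ.expand τ
  letI := (ρ.comap f).expand τ
  { toFun := f
    inj' := f.injective
    map_fun' := by
      rintro n (g | g) xs
      · exact f.map_fun g xs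
      · nomatch g
    map_rel' := by
      rintro n (r | r) xs
      · exact f.map_rel r xs
      · exact Iff.rfl }

/-- The Tarski–Vaught test, for the vocabulary expanded by the relation variables. -/
theorem holds_comap_of_exists (ρ : RelAssignment Γ M) (f : K ↪[τ] M)
    (h : ∀ (n : ℕ) (φ : (withRelVars τ Γ).BoundedFormula Empty (n + 1)) (x : Fin n → K) (a : M),
      ρ.Holds φ (Fin.snoc (f ∘ x) a : _ → M) →
        ∃ b : K, ρ.Holds φ (Fin.snoc (f ∘ x) (f b) : _ → M))
    {n : ℕ} (φ : (withRelVars τ Γ).BoundedFormula Empty n) (xs : Fin n → K) :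
    (ρ.comap f).Holds φ xs ↔ ρ.Holds φ (f ∘ xs) := by
  let := ρ.expand τ
  let := (ρ.comap f).expand τ
  have := ((ρ.comapEmbedding f).toElementaryEmbedding h).map_boundedFormula φ default xs
  rw [Subsingleton.elim (_ ∘ default) (default : Empty → M)] at this
  exact this.symm

theorem holds_comap_equiv (ρ : RelAssignment Γ M) (e : K ≃[τ] M)
    {n : ℕ} (φ : (withRelVars τ Γ).BoundedFormula Empty n) (xs : Fin n → K) :
    (ρ.comap e).Holds φ xs ↔ ρ.Holds φ (e ∘ xs) :=
  ρ.holds_comap_of_exists e.toEmbedding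
    (fun _ _ _ a h => ⟨e.symm a, by simpa using! h⟩) φ xs

end RelAssignment

/-! ### Invariance of truth under isomorphism -/

namespace PosFormula

variable {c : Prop} {τ : FirstOrder.Language.{u, u}} {𝒜 : Set (Set (ℕ → Bool))} {Γ : List ℕ}

/-- The tree structure that is defined by a quintuple of first order formulas. -/
def qTree {M : Type u} [τ.Structure M] {n : ℕ}
    (ψ₀ ψ₁ ψ₂ : (withRelVars τ Γ).BoundedFormula Empty (n + 2))
    (ψ₃ ψ₄ : (withRelVars τ Γ).BoundedFormula Empty (n + 1)) (ρ : RelAssignment Γ M)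
    (xs : Fin n → M) : TreeStructure M where
  R₀ a b := ρ.Holds ψ₀ (Fin.snoc (Fin.snoc xs a : Fin _ → M) b)
  R₁ a b := ρ.Holds ψ₁ (Fin.snoc (Fin.snoc xs a : Fin _ → M) b)
  R₂ a b := ρ.Holds ψ₂ (Fin.snoc (Fin.snoc xs a : Fin _ → M) b)
  R₃ a := ρ.Holds ψ₃ (Fin.snoc xs a)
  R₄ a := ρ.Holds ψ₄ (Fin.snoc xs a)

theorem realize_Q {M : Type u} [τ.Structure M] {n : ℕ}
    {ψ₀ ψ₁ ψ₂ : (withRelVars τ Γ).BoundedFormula Empty (n + 2)}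
    {ψ₃ ψ₄ : (withRelVars τ Γ).BoundedFormula Empty (n + 1)} {ρ : RelAssignment Γ M}
    {xs : Fin n → M} : (Q ψ₀ ψ₁ ψ₂ ψ₃ ψ₄ : PosFormula c τ Γ n).Realize 𝒜 ρ xs ↔
      (qTree ψ₀ ψ₁ ψ₂ ψ₃ ψ₄ ρ xs).MemQuantifier 𝒜 :=
  Iff.rfl

theorem qTree_comap {M K : Type u} [τ.Structure M] [τ.Structure K] {f : K → M}
    {ρ : RelAssignment Γ M}
    (h : ∀ {n : ℕ} (φ : (withRelVars τ Γ).BoundedFormula Empty n) (xs : Fin n → K),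
      (ρ.comap f).Holds φ xs ↔ ρ.Holds φ (f ∘ xs)) {n : ℕ}
    (ψ₀ ψ₁ ψ₂ : (withRelVars τ Γ).BoundedFormula Empty (n + 2))
    (ψ₃ ψ₄ : (withRelVars τ Γ).BoundedFormula Empty (n + 1)) (xs : Fin n → K) :
    qTree ψ₀ ψ₁ ψ₂ ψ₃ ψ₄ (ρ.comap f) xs = (qTree ψ₀ ψ₁ ψ₂ ψ₃ ψ₄ ρ (f ∘ xs)).comap f := by
  simp only [qTree, TreeStructure.comap, h, Fin.comp_snoc]

theorem Realize.comap_equiv {M K : Type u} [τ.Structure M] [τ.Structure K] (e : K ≃[τ] M)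
    {n : ℕ} {φ : PosFormula c τ Γ n} {ρ : RelAssignment Γ M} {xs : Fin n → K}
    (h : φ.Realize 𝒜 ρ (e ∘ xs)) : φ.Realize 𝒜 (ρ.comap e) xs := by
  induction φ with
  | fo φ => exact (ρ.holds_comap_equiv e φ xs).2 h
  | and φ ψ ih₁ ih₂ => exact ⟨ih₁ h.1, ih₂ h.2⟩
  | or φ ψ ih₁ ih₂ => exact h.imp ih₁ ih₂
  | ex φ ih =>
    obtain ⟨a, ha⟩ := h
    refine ⟨e.symm a, ih ?_⟩
    rw [Fin.comp_snoc]
    simpa using! ha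
  | all φ ih =>
    refine fun a => ih ?_
    rw [Fin.comp_snoc]
    exact h (e a)
  | exRel k φ ih =>
    obtain ⟨R, hR⟩ := h
    refine ⟨fun ys => R (e ∘ ys), ?_⟩
    rw [← RelAssignment.comap_cons]
    exact ih hR
  | countableAnd _ φ ih => exact fun i => ih i (h i)
  | Q ψ₀ ψ₁ ψ₂ ψ₃ ψ₄ =>
    rw [realize_Q] at h ⊢
    rw [qTree_comap (ρ.holds_comap_equiv e)]
    exact h.comap_of_bijective e.bijective

/-! ## Translations between vocabularies -/

/-- Translate the first order parts of a formula. -/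
def mapFirstOrder {τ' : FirstOrder.Language.{u, u}} (k : ℕ)
    (T : ∀ {Γ : List ℕ} {n : ℕ}, (withRelVars τ Γ).BoundedFormula Empty n →
      (withRelVars τ' Γ).BoundedFormula Empty (k + n)) :
    ∀ {Γ : List ℕ} {n : ℕ}, PosFormula c τ Γ n → PosFormula c τ' Γ (k + n)
  | _, _, fo φ => fo (T φ)
  | _, _, and φ ψ => and (φ.mapFirstOrder k T) (ψ.mapFirstOrder k T)
  | _, _, or φ ψ => or (φ.mapFirstOrder k T) (ψ.mapFirstOrder k T)
  | _, _, ex φ => ex (φ.mapFirstOrder k T)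
  | _, _, all φ => all (φ.mapFirstOrder k T)
  | _, _, exRel j φ => exRel j (φ.mapFirstOrder k T)
  | _, _, countableAnd h φ => countableAnd h fun i => (φ i).mapFirstOrder k T
  | _, _, Q ψ₀ ψ₁ ψ₂ ψ₃ ψ₄ => Q (T ψ₀) (T ψ₁) (T ψ₂) (T ψ₃) (T ψ₄)

theorem snoc_comp_natAdd {M : Type u} {k n : ℕ} (xs : Fin (k + n) → M) (b : M) :
    (Fin.snoc xs b : Fin (k + n + 1) → M) ∘ Fin.natAdd k (m := n + 1) =
      Fin.snoc (xs ∘ Fin.natAdd k) b := by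
  funext i
  refine Fin.lastCases ?_ (fun i => ?_) i
  · exact (Fin.snoc_last (α := fun _ => M) b xs).trans
      (Fin.snoc_last (α := fun _ => M) b (xs ∘ Fin.natAdd k)).symm
  · exact (Fin.snoc_castSucc (α := fun _ => M) b xs (Fin.natAdd k i)).trans
      (Fin.snoc_castSucc (α := fun _ => M) b (xs ∘ Fin.natAdd k) i).symm

theorem snoc_castAdd {M : Type u} {k n : ℕ} (xs : Fin (k + n) → M) (b : M) (i : Fin k) :
    (Fin.snoc xs b : Fin (k + n + 1) → M) (Fin.castAdd (n + 1) i) = xs (Fin.castAdd n i) :=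
  Fin.snoc_castSucc (α := fun _ => M) b xs (Fin.castAdd n i)

/-- The first `k` variables are parameters with fixed values `a`. Quantifiers bind variables at the
other end, so the parameters survive the induction. The case `k = 0` serves for renaming, and `k =
1` for replacing a constant symbol by a variable. -/
theorem realize_mapFirstOrder {τ' : FirstOrder.Language.{u, u}} {k : ℕ}
    {T : ∀ {Γ : List ℕ} {n : ℕ}, (withRelVars τ Γ).BoundedFormula Empty n →
      (withRelVars τ' Γ).BoundedFormula Empty (k + n)}
    {M : Type u} [τ.Structure M] [τ'.Structure M] {a : Fin k → M}
    (hT : ∀ {Γ : List ℕ} {n : ℕ} (φ : (withRelVars τ Γ).BoundedFormula Empty n)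
      (ρ : RelAssignment Γ M) (xs : Fin (k + n) → M), (∀ i, xs (Fin.castAdd n i) = a i) →
        (ρ.Holds (T φ) xs ↔ ρ.Holds φ (xs ∘ Fin.natAdd k)))
    {n : ℕ} (φ : PosFormula c τ Γ n) (ρ : RelAssignment Γ M) (xs : Fin (k + n) → M)
    (hxs : ∀ i, xs (Fin.castAdd n i) = a i) :
    (φ.mapFirstOrder k T).Realize 𝒜 ρ xs ↔ φ.Realize 𝒜 ρ (xs ∘ Fin.natAdd k) := by
  have hs : ∀ {n : ℕ} (xs : Fin (k + n) → M) (b : M), (∀ i, xs (Fin.castAdd n i) = a i) →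
      ∀ i, (Fin.snoc xs b : Fin (k + n + 1) → M) (Fin.castAdd (n + 1) i) = a i :=
    fun xs b h i => (snoc_castAdd xs b i).trans (h i)
  induction φ with
  | fo φ => exact hT φ ρ xs hxs
  | and φ ψ ih₁ ih₂ => exact and_congr (ih₁ ρ xs hxs) (ih₂ ρ xs hxs)
  | or φ ψ ih₁ ih₂ => exact or_congr (ih₁ ρ xs hxs) (ih₂ ρ xs hxs)
  | ex φ ih =>
    refine exists_congr fun b => (ih ρ _ (hs xs b hxs)).trans ?_
    rw [snoc_comp_natAdd]
  | all φ ih =>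
    refine forall_congr' fun b => (ih ρ _ (hs xs b hxs)).trans ?_
    rw [snoc_comp_natAdd]
  | exRel k φ ih => exact exists_congr fun R => ih _ xs hxs
  | countableAnd _ φ ih => exact forall_congr' fun i => ih i ρ xs hxs
  | @Q Γ n ψ₀ ψ₁ ψ₂ ψ₃ ψ₄ =>
    have h₂ : ∀ (ψ : (withRelVars τ Γ).BoundedFormula Empty (n + 2)) (b d : M),
        ρ.Holds (T ψ) (Fin.snoc (Fin.snoc xs b : Fin (k + n + 1) → M) d) ↔
          ρ.Holds ψ (Fin.snoc (Fin.snoc (xs ∘ Fin.natAdd k) b : Fin (n + 1) → M) d) :=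
      fun ψ b d => (hT ψ ρ _ (hs (n := n + 1) _ d (hs xs b hxs))).trans
        (by rw [snoc_comp_natAdd (n := n + 1), snoc_comp_natAdd])
    have h₁ : ∀ (ψ : (withRelVars τ Γ).BoundedFormula Empty (n + 1)) (b : M),
        ρ.Holds (T ψ) (Fin.snoc xs b : Fin (k + n + 1) → M) ↔
          ρ.Holds ψ (Fin.snoc (xs ∘ Fin.natAdd k) b : Fin (n + 1) → M) :=
      fun ψ b => (hT ψ ρ _ (hs xs b hxs)).trans (by rw [snoc_comp_natAdd])
    have : qTree (n := k + n) (T (n := n + 2) ψ₀) (T (n := n + 2) ψ₁) (T (n := n + 2) ψ₂)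
        (T (n := n + 1) ψ₃) (T (n := n + 1) ψ₄) ρ xs =
        qTree ψ₀ ψ₁ ψ₂ ψ₃ ψ₄ ρ (xs ∘ Fin.natAdd k) := by
      unfold qTree
      congr 1 <;> funext b
      · exact funext fun d => propext (h₂ ψ₀ b d)
      · exact funext fun d => propext (h₂ ψ₁ b d)
      · exact funext fun d => propext (h₂ ψ₂ b d)
      · exact propext (h₁ ψ₃ b)
      · exact propext (h₁ ψ₄ b)
    exact iff_of_eq (congrArg (TreeStructure.MemQuantifier · 𝒜) this)

end PosFormula
/-! ## The logics are positive -/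

namespace Logic

open FirstOrder.Language PosFormula

/-- The common form of the logics `L^{d⁻}_𝒜` and `L^{d⁻,ω}_𝒜`. -/
def dLogic (c : Prop) (𝒜 : Set (Set (ℕ → Bool))) : Logic.{u, u} where
  Sentence τ := PosFormula c τ [] 0
  Sat φ M _ := φ.Realize 𝒜 (RelAssignment.empty M) default

/-- Rename the symbols of a first order formula with relation variables. -/
def renameFormula {τ τ' : FirstOrder.Language.{u, u}} (f : τ →ᴸ τ') {Γ : List ℕ} {n : ℕ}
    (φ : (withRelVars τ Γ).BoundedFormula Empty n) :
    (withRelVars τ' Γ).BoundedFormula Empty (0 + n) :=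
  -- The relabelling along the empty map only changes the index `n` to `0 + n`, the form that
  -- `mapFirstOrder` expects.
  ((f.sumMap (LHom.id (relVarLanguage Γ))).onBoundedFormula φ).relabel
    (Empty.elim : Empty → Empty ⊕ Fin 0)

theorem holds_renameFormula {τ τ' : FirstOrder.Language.{u, u}} (f : τ →ᴸ τ') {Γ : List ℕ} {n : ℕ}
    (φ : (withRelVars τ Γ).BoundedFormula Empty n) {M : Type u} [τ.Structure M] [τ'.Structure M]
    [f.IsExpansionOn M] (ρ : RelAssignment Γ M) (xs : Fin (0 + n) → M) :
    ρ.Holds (renameFormula f φ) xs ↔ ρ.Holds φ (xs ∘ Fin.natAdd 0) := by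
  let s := ρ.expand τ
  let s' := ρ.expand τ'
  have : (f.sumMap (LHom.id (relVarLanguage Γ))).IsExpansionOn M :=
    ⟨fun {n} g xs => g.casesOn (fun g => f.map_onFunction g xs) (fun g => nomatch g),
      fun {n} r xs => r.casesOn (fun r => f.map_onRelation r xs) (fun r => rfl)⟩
  refine BoundedFormula.realize_relabel.trans ?_
  rw [LHom.realize_onBoundedFormula, Subsingleton.elim (_ ∘ Empty.elim) (default : Empty → M)]
  rfl

/-- The reordering of vocabularies that makes a constant symbol the last one to be added. -/
def constantLast (τ : FirstOrder.Language.{u, u}) (Γ : List ℕ) :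
    withRelVars (τ.withConstants PUnit.{u + 1}) Γ →ᴸ
      (withRelVars τ Γ).withConstants PUnit.{u + 1} :=
  ((LHom.sumInl.comp LHom.sumInl).sumElim LHom.sumInr).sumElim (LHom.sumInl.comp LHom.sumInr)

/-- Replace a constant symbol by a new first variable. -/
def constantToVar {τ : FirstOrder.Language.{u, u}} {Γ : List ℕ} {n : ℕ}
    (φ : (withRelVars (τ.withConstants PUnit.{u + 1}) Γ).BoundedFormula Empty n) :
    (withRelVars τ Γ).BoundedFormula Empty (1 + n) :=
  (BoundedFormula.constantsVarsEquiv ((constantLast τ Γ).onBoundedFormula φ)).relabel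
    (fun _ => Sum.inr 0 : PUnit.{u + 1} ⊕ Empty → Empty ⊕ Fin 1)

theorem holds_constantToVar {τ : FirstOrder.Language.{u, u}} {Γ : List ℕ} {n : ℕ}
    (φ : (withRelVars (τ.withConstants PUnit.{u + 1}) Γ).BoundedFormula Empty n) {M : Type u}
    [τ.Structure M] (a : M) (ρ : RelAssignment Γ M) (xs : Fin (1 + n) → M)
    (hxs : xs (Fin.castAdd n 0) = a) :
    ρ.Holds (constantToVar φ) xs ↔
      @RelAssignment.Holds _ M (expandConstant τ M a) _ _ ρ φ (xs ∘ Fin.natAdd 1) := by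
  let s₁ := ρ.expand τ
  let s₂ := expandConstant τ M a
  let s₃ := ρ.expand (τ.withConstants PUnit.{u + 1})
  let s₄ := expandConstant (withRelVars τ Γ) M a
  have : (constantLast τ Γ).IsExpansionOn M :=
    ⟨fun {n} g xs => by rcases g with (g | g) | g <;> rfl,
      fun {n} r xs => by rcases r with (r | r) | r <;> rfl⟩
  have : (lhomWithConstants (withRelVars τ Γ) PUnit.{u + 1}).IsExpansionOn M :=
    ⟨fun {n} g xs => rfl, fun {n} r xs => rfl⟩
  refine BoundedFormula.realize_relabel.trans ?_
  have hv : (Sum.elim (default : Empty → M) (xs ∘ Fin.castAdd n) ∘ fun _ => Sum.inr 0 : PUnit ⊕ Empty → M) =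
      Sum.elim (fun i : PUnit.{u + 1} => (((withRelVars τ Γ).con i : _) : M)) default := by
    funext i
    rcases i with i | i
    · exact hxs
    · nomatch i
  rw [hv, BoundedFormula.realize_constantsVarsEquiv, LHom.realize_onBoundedFormula]
  rfl

theorem dLogic_realize_constantToVar {c : Prop} {𝒜 : Set (Set (ℕ → Bool))}
    {τ : FirstOrder.Language.{u, u}}
    (φ : (dLogic c 𝒜).Sentence (τ.withConstants PUnit.{u + 1})) {M : Type u} [τ.Structure M]
    (a : M) :
    (mapFirstOrder 1 constantToVar φ : PosFormula c τ [] 1).Realize 𝒜 (RelAssignment.empty M)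
      (Fin.snoc (default : Fin 0 → M) a) ↔ @Sat (dLogic c 𝒜) _ φ M (expandConstant τ M a) := by
  let s := expandConstant τ M a
  refine (realize_mapFirstOrder (a := fun _ => a) (fun φ ρ xs h => holds_constantToVar φ a ρ xs
    (h 0)) φ (RelAssignment.empty M) _ fun i => ?_).trans ?_
  · rw [Subsingleton.elim i 0]
    rfl
  · rw [Subsingleton.elim (_ ∘ Fin.natAdd 1) (default : Fin 0 → M)]
    rfl

theorem firstOrder_sublogic_dLogic (c : Prop) (𝒜 : Set (Set (ℕ → Bool))) :
    firstOrder.Sublogic (dLogic.{u} c 𝒜) := by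
  intro τ φ
  refine ⟨fo (LHom.sumInl.onSentence φ), fun M _ _ => ?_⟩
  let s := (RelAssignment.empty M).expand τ
  have : (LHom.sumInl : τ →ᴸ withRelVars τ []).IsExpansionOn M :=
    ⟨fun {n} g xs => rfl, fun {n} r xs => rfl⟩
  exact (LHom.realize_onSentence M (LHom.sumInl : τ →ᴸ withRelVars τ []) φ).symm

theorem isPositive_dLogic (c : Prop) (𝒜 : Set (Set (ℕ → Bool))) :
    (dLogic.{u} c 𝒜).IsPositive where
  iso φ M N _ _ _ _ e h := by
    obtain ⟨e⟩ := e
    have := Realize.comap_equiv e.symm (𝒜 := 𝒜) (φ := φ) (ρ := RelAssignment.empty M)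
      (xs := default) (by rwa [Subsingleton.elim (_ ∘ default) (default : Fin 0 → M)])
    rwa [RelAssignment.eq_empty ((RelAssignment.empty M).comap _)] at this
  conj φ ψ := ⟨and φ ψ, fun M _ _ => Iff.rfl⟩
  rename {τ τ'} f _ φ := by
    refine ⟨mapFirstOrder 0 (renameFormula f) φ, fun M _ _ => ?_⟩
    let s := f.reduct M
    have : f.IsExpansionOn M := f.isExpansionOn_reduct M
    exact realize_mapFirstOrder (k := 0) (a := Fin.elim0)
      (fun φ ρ xs _ => holds_renameFormula f φ ρ xs) φ _ _ fun i => i.elim0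
  firstOrder_le := firstOrder_sublogic_dLogic c 𝒜
  disj φ ψ := ⟨or φ ψ, fun M _ _ => Iff.rfl⟩
  ex {τ} φ := ⟨ex (n := 0) (mapFirstOrder 1 constantToVar φ : PosFormula c τ [] 1), fun M _ _ =>
    exists_congr fun a => dLogic_realize_constantToVar φ a⟩
  all {τ} φ := ⟨all (n := 0) (mapFirstOrder 1 constantToVar φ : PosFormula c τ [] 1), fun M _ _ =>
    forall_congr' fun a => dLogic_realize_constantToVar φ a⟩

/-! ## Existential second order sentences -/

/-- Quantify existentially over all relation variables in the context. -/
def exRels {c : Prop} {τ : FirstOrder.Language.{u, u}} :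
    ∀ {Γ : List ℕ}, PosFormula c τ Γ 0 → PosFormula c τ [] 0
  | [], φ => φ
  | k :: _, φ => exRels (exRel k φ)

theorem realize_exRels {c : Prop} {𝒜 : Set (Set (ℕ → Bool))} {τ : FirstOrder.Language.{u, u}}
    {M : Type u} [τ.Structure M] {Γ : List ℕ} (φ : PosFormula c τ Γ 0) :
    (exRels φ).Realize 𝒜 (RelAssignment.empty M) default ↔
      ∃ ρ : RelAssignment Γ M, φ.Realize 𝒜 ρ default := by
  induction Γ with
  | nil =>
    refine ⟨fun h => ⟨_, h⟩, ?_⟩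
    rintro ⟨ρ, h⟩
    rwa [ρ.eq_empty] at h
  | cons k Γ ih =>
    refine (ih (exRel k φ)).trans ⟨?_, ?_⟩
    · rintro ⟨ρ, R, h⟩
      exact ⟨_, h⟩
    · rintro ⟨ρ, h⟩
      obtain ⟨R, σ, rfl⟩ := ρ.exists_cons
      exact ⟨σ, R, h⟩

theorem sigma11_sublogic_dLogic (c : Prop) (𝒜 : Set (Set (ℕ → Bool))) :
    sigma11.Sublogic (dLogic.{u} c 𝒜) := fun φ =>
  ⟨exRels (fo φ.2), fun _ _ _ => (realize_exRels (c := c) (𝒜 := 𝒜) (fo φ.2)).symm⟩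

theorem sigma11Delta_sublogic_dLogic (𝒜 : Set (Set (ℕ → Bool))) :
    sigma11Delta.Sublogic (dLogic.{u} True 𝒜) := fun φ =>
  ⟨exRels (countableAnd trivial fun i => fo (φ.2 i)), fun _ _ _ =>
    (realize_exRels (𝒜 := 𝒜) (countableAnd trivial fun i => fo (φ.2 i))).symm⟩

theorem Sublogic.trans {L₁ : Logic.{u, v}} {L₂ : Logic.{u, w}} {L₃ : Logic.{u, v}}
    (h : L₁.Sublogic L₂) (h' : L₂.Sublogic L₃) : L₁.Sublogic L₃ := fun φ => by
  obtain ⟨ψ, hψ⟩ := h φ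
  obtain ⟨χ, hχ⟩ := h' ψ
  exact ⟨χ, fun M _ _ => (hψ M).trans (hχ M)⟩

end Logic
/-! ## Ultraproducts and compactness -/

section Ultraproduct

open Filter FirstOrder.Language

/-- Choice of witnesses along a filter; at indices without a witness the chosen value is arbitrary.
-/
theorem exists_forall_of_eventually_exists {I : Type*} {β : I → Type*} [∀ i, Nonempty (β i)]
    {l : Filter I} {P : ∀ i, β i → Prop} (h : ∀ᶠ i in l, ∃ y, P i y) :
    ∃ f : ∀ i, β i, ∀ᶠ i in l, P i (f i) :=
  ⟨fun i => Classical.epsilon (P i), h.mono fun _ hi => Classical.epsilon_spec hi⟩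

variable {I : Type u} {U : Ultrafilter I} {M : I → Type u}

theorem TreeStructure.MemQuantifier.ultraproduct {𝒜 : Set (Set (ℕ → Bool))}
    (hdense : ∀ B ∈ 𝒜, Dense B) (htop : ⋃₀ 𝒜 ∈ 𝒜) {l : I → ℕ} (hl : Tendsto l U atTop)
    {T : TreeStructure ((U : Filter I).Product M)} {N : ∀ i, TreeStructure (M i)}
    (h₀ : ∀ a b : ∀ i, M i, T.R₀ a b ↔ ∀ᶠ i in U, (N i).R₀ (a i) (b i))
    (h₁ : ∀ a b : ∀ i, M i, T.R₁ a b ↔ ∀ᶠ i in U, (N i).R₁ (a i) (b i))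
    (h₂ : ∀ a b : ∀ i, M i, T.R₂ a b ↔ ∀ᶠ i in U, (N i).R₂ (a i) (b i))
    (h₃ : ∀ a : ∀ i, M i, T.R₃ a ↔ ∀ᶠ i in U, (N i).R₃ (a i))
    (h₄ : ∀ a : ∀ i, M i, T.R₄ a ↔ ∀ᶠ i in U, (N i).R₄ (a i))
    [∀ i, Nonempty (M i)]
    (h : ∀ᶠ i in U, (N i).MemQuantifier 𝒜) : T.MemQuantifier 𝒜 := by
  have heq : ∀ a b : ∀ i, M i,
      (a : (U : Filter I).Product M) = (b : (U : Filter I).Product M) ↔ ∀ᶠ i in U, a i = b i :=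
    fun a b => Quotient.eq''
  have htree : ∀ᶠ i in U, (N i).IsTreeLike := h.mono fun i hi => hi.1
  -- Each condition is first order and transfers separately; the disjunction in `tree` is where `U`
  -- must be an ultrafilter.
  have hT : T.IsTreeLike := by
    constructor
    · have : ∀ᶠ i in U, ∃ x, (N i).R₃ x ∧ ∀ y, (N i).R₄ y → (N i).R₂ x y :=
        htree.mono fun i hi => hi.root
      obtain ⟨x, hx⟩ := exists_forall_of_eventually_exists this
      refine ⟨x, (h₃ x).2 (hx.mono fun i hi => hi.1), ?_⟩
      rintro ⟨y⟩ hy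
      exact (h₂ x y).2 ((hx.and ((h₄ y).1 hy)).mono fun i hi => hi.1.2 _ hi.2)
    · rintro ⟨x⟩ ⟨y⟩ hx hy
      exact (heq x y).2 ((htree.and (((h₃ x).1 hx).and ((h₃ y).1 hy))).mono
        fun i hi => hi.1.root_unique _ _ hi.2.1 hi.2.2)
    · rintro ⟨x⟩ ⟨y⟩ hxy
      exact (h₂ x y).2 ((htree.and ((h₀ x y).1 hxy)).mono fun i hi => hi.1.zero_le _ _ hi.2)
    · rintro ⟨x⟩ ⟨y⟩ hxy
      exact (h₂ x y).2 ((htree.and ((h₁ x y).1 hxy)).mono fun i hi => hi.1.one_le _ _ hi.2)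
    · rintro ⟨x⟩ ⟨y⟩ hxy
      have := htree.and ((h₂ x y).1 hxy)
      exact ⟨(h₄ x).2 (this.mono fun i hi => (hi.1.field _ _ hi.2).1),
        (h₄ y).2 (this.mono fun i hi => (hi.1.field _ _ hi.2).2)⟩
    · rintro ⟨x⟩ hx
      exact (h₂ x x).2 ((htree.and ((h₄ x).1 hx)).mono fun i hi => hi.1.refl _ hi.2)
    · rintro ⟨x⟩ ⟨y⟩ ⟨z⟩ hxy hyz
      exact (h₂ x z).2 ((htree.and (((h₂ x y).1 hxy).and ((h₂ y z).1 hyz))).mono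
        fun i hi => hi.1.trans _ _ _ hi.2.1 hi.2.2)
    · rintro ⟨x⟩ ⟨y⟩ hxy hyx
      exact (heq x y).2 ((htree.and (((h₂ x y).1 hxy).and ((h₂ y x).1 hyx))).mono
        fun i hi => hi.1.antisymm _ _ hi.2.1 hi.2.2)
    · rintro ⟨x⟩ ⟨y⟩ ⟨z⟩ hyx hzx
      have := (htree.and (((h₂ y x).1 hyx).and ((h₂ z x).1 hzx))).mono
        fun i hi => hi.1.tree _ _ _ hi.2.1 hi.2.2
      exact (Ultrafilter.eventually_or.1 this).imp (h₂ y z).2 (h₂ z y).2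
    · rintro ⟨x⟩ ⟨y⟩ ⟨z⟩ hxy hxz
      exact (heq y z).2 ((htree.and (((h₀ x y).1 hxy).and ((h₀ x z).1 hxz))).mono
        fun i hi => hi.1.zero_unique _ _ _ hi.2.1 hi.2.2)
    · rintro ⟨x⟩ ⟨y⟩ ⟨z⟩ hxy hxz
      exact (heq y z).2 ((htree.and (((h₁ x y).1 hxy).and ((h₁ x z).1 hxz))).mono
        fun i hi => hi.1.one_unique _ _ _ hi.2.1 hi.2.2)
    · rintro ⟨x⟩ ⟨y⟩ ⟨z⟩ hxy hxz
      have := (htree.and (((h₀ x y).1 hxy).and ((h₁ x z).1 hxz))).mono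
        fun i hi => hi.1.zero_one _ _ _ hi.2.1 hi.2.2
      constructor
      · intro hyz
        exact (this.and ((h₂ y z).1 hyz)).exists.elim fun i hi => hi.1.1 hi.2
      · intro hzy
        exact (this.and ((h₂ z y).1 hzy)).exists.elim fun i hi => hi.1.2 hi.2
  -- By density, the `i`-th factor represents some `θ` that agrees with `η` on the first `l i` bits.
  -- The classes of the representing elements and of their paths then represent all of `η`, since
  -- `l` exceeds every fixed length almost everywhere.
  have hΩ : T.Omega = Set.univ := by
    refine Set.eq_univ_of_forall fun η => ?_
    have hrep : ∀ᶠ i in U, ∃ p : M i × (ℕ → M i), (N i).R₄ p.1 ∧ (N i).R₃ (p.2 0) ∧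
        (∀ m ≤ l i, (N i).R₄ (p.2 m)) ∧
        (∀ m < l i, (N i).bit (η m) (p.2 m) (p.2 (m + 1))) ∧ ∀ m ≤ l i, (N i).R₂ (p.2 m) p.1 := by
      refine h.mono fun i hi => ?_
      have ho : IsOpen {θ : ℕ → Bool | ∀ m < l i, η m = θ m} := by
        simp only [Set.ofPred_forall]
        exact (Set.finite_lt_nat (l i)).isOpen_biInter fun m _ =>
          (isOpen_discrete {b | η m = b}).preimage (continuous_apply m)
      obtain ⟨θ, hθ, ⟨a, ha⟩, -⟩ := (hdense _ hi.2).inter_open_nonempty _ ho ⟨η, fun _ _ => rfl⟩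
      obtain ⟨ha, y, hy⟩ := (ha (l i)).congr (θ := η) fun m hm => (hθ m hm).symm
      exact ⟨⟨a, y⟩, ha, hy⟩
    obtain ⟨p, hp⟩ := exists_forall_of_eventually_exists hrep
    have hle : ∀ m, ∀ᶠ i in U, m ≤ l i := fun m => hl.eventually_ge_atTop m
    refine ⟨((fun i => (p i).1 : ∀ i, M i) : (U : Filter I).Product M), fun n =>
      ⟨(h₄ _).2 (hp.mono fun i hi => hi.1),
      fun m => ((fun i => (p i).2 m : ∀ i, M i) : (U : Filter I).Product M),
      (h₃ _).2 (hp.mono fun i hi => hi.2.1),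
      fun m _ => (h₄ _).2 ((hp.and (hle m)).mono fun i hi => hi.1.2.2.1 m hi.2), fun m _ => ?_,
      fun m _ => (h₂ _ _).2 ((hp.and (hle m)).mono fun i hi => hi.1.2.2.2.2 m hi.2)⟩⟩
    have := (hp.and (hle (m + 1))).mono fun i hi => hi.1.2.2.2.1 m hi.2
    cases hb : η m
    · simp only [hb] at this
      exact (h₀ _ _).2 this
    · simp only [hb] at this
      exact (h₁ _ _).2 this
  refine ⟨hT, ?_⟩
  rwa [hΩ, Set.univ_inter]

/-! ### Łoś's theorem and the preservation of positive formulas -/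

variable {τ : FirstOrder.Language.{u, u}} [∀ i, τ.Structure (M i)] {Γ : List ℕ}

/-- The ultraproduct of assignments. -/
def RelAssignment.ultraproduct (ρ : ∀ i, RelAssignment Γ (M i)) :
    RelAssignment Γ ((U : Filter I).Product M) := fun _ r ys =>
  letI := fun i => (ρ i).expand τ
  Structure.RelMap (L := withRelVars τ Γ) (Sum.inr r) ys

theorem RelAssignment.ultraproduct_cons (ρ : ∀ i, RelAssignment Γ (M i)) {k : ℕ}
    (R : ∀ i, (Fin k → M i) → Prop) :
    ∃ R' : (Fin k → (U : Filter I).Product M) → Prop,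
      ultraproduct (τ := τ) (U := U) (fun i => (ρ i).cons (R i)) =
        (ultraproduct (τ := τ) (U := U) ρ).cons R' := by
  refine ⟨ultraproduct (τ := τ) (fun i => (ρ i).cons (R i)) .head, ?_⟩
  funext j r
  cases r <;> rfl

variable [∀ i, Nonempty (M i)]

theorem RelAssignment.holds_ultraproduct (ρ : ∀ i, RelAssignment Γ (M i)) {n : ℕ}
    (φ : (withRelVars τ Γ).BoundedFormula Empty n) (x : Fin n → ∀ i, M i) :
    (ultraproduct (τ := τ) ρ).Holds φ (fun j => (x j : (U : Filter I).Product M)) ↔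
      ∀ᶠ i in U, (ρ i).Holds φ fun j => x j i := by
  let s := fun i => (ρ i).expand τ
  have hs : (ultraproduct (τ := τ) (U := U) ρ).expand τ =
      @Ultraproduct.structure I M U (withRelVars τ Γ) s := by
    ext n g xs
    · rcases g with g | g
      · rfl
      · nomatch g
    · rcases g with g | g
      · rfl
      · rfl
  have := @Ultraproduct.boundedFormula_realize_cast I M U (withRelVars τ Γ) s _ Empty n φ
    (fun e => nomatch e) x
  change @BoundedFormula.Realize _ _ ((ultraproduct (τ := τ) (U := U) ρ).expand τ) _ _ φ _ _ ↔ _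
  rw [hs]
  refine (iff_of_eq ?_).trans (this.trans (eventually_congr (.of_forall fun i => iff_of_eq ?_)))
  · congr 1
    exact Subsingleton.elim _ _
  · exact congrArg (fun v => φ.Realize v fun j => x j i) (Subsingleton.elim _ _)

/-- Only this direction of Łoś's theorem survives beyond first order logic, and compactness needs no
more. Countable conjunctions cause no trouble: each conjunct is treated alone, so no countable
completeness of `U` is involved. -/
theorem PosFormula.Realize.ultraproduct {c : Prop} {𝒜 : Set (Set (ℕ → Bool))}
    (hdense : ∀ B ∈ 𝒜, Dense B) (htop : ⋃₀ 𝒜 ∈ 𝒜) {l : I → ℕ} (hl : Tendsto l U atTop)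
    {n : ℕ} {φ : PosFormula c τ Γ n} {ρ : ∀ i, RelAssignment Γ (M i)} {x : Fin n → ∀ i, M i}
    (h : ∀ᶠ i in U, φ.Realize 𝒜 (ρ i) fun j => x j i) :
    φ.Realize 𝒜 (RelAssignment.ultraproduct (τ := τ) ρ)
      fun j => (x j : (U : Filter I).Product M) := by
  have hsnoc : ∀ {n : ℕ} (x : Fin n → ∀ i, M i) (a : ∀ i, M i),
      (Fin.snoc (fun j => (x j : (U : Filter I).Product M)) (a : (U : Filter I).Product M) :
        Fin (n + 1) → (U : Filter I).Product M) =
      fun j => ((Fin.snoc x a : Fin (n + 1) → ∀ i, M i) j : (U : Filter I).Product M) :=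
    fun x a => (Fin.comp_snoc (fun b : ∀ i, M i => (b : (U : Filter I).Product M)) x a).symm
  have hsnoc' : ∀ {n : ℕ} (x : Fin n → ∀ i, M i) (a : ∀ i, M i) (i : I),
      (fun j => (Fin.snoc x a : Fin (n + 1) → ∀ i, M i) j i) =
        (Fin.snoc (fun j => x j i) (a i) : Fin (n + 1) → M i) :=
    fun x a i => Fin.comp_snoc (fun b : ∀ i, M i => b i) x a
  induction φ with
  | fo φ => exact (RelAssignment.holds_ultraproduct ρ φ x).2 h
  | and φ ψ ih₁ ih₂ => exact ⟨ih₁ (h.mono fun i hi => hi.1), ih₂ (h.mono fun i hi => hi.2)⟩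
  | or φ ψ ih₁ ih₂ => exact (Ultrafilter.eventually_or.1 h).imp (fun h => ih₁ h) fun h => ih₂ h
  | ex φ ih =>
    obtain ⟨a, ha⟩ := exists_forall_of_eventually_exists h
    refine ⟨(a : (U : Filter I).Product M), ?_⟩
    rw [hsnoc]
    exact ih (ha.mono fun i hi => by rwa [hsnoc'])
  | all φ ih =>
    rintro ⟨a⟩
    refine (congrArg _ (hsnoc x a)).mpr (ih (h.mono fun i hi => ?_))
    rw [hsnoc']
    exact hi (a i)
  | exRel k φ ih =>
    obtain ⟨R, hR⟩ := exists_forall_of_eventually_exists h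
    obtain ⟨R', hR'⟩ := RelAssignment.ultraproduct_cons (τ := τ) (U := U) ρ R
    refine ⟨R', ?_⟩
    rw [← hR']
    exact ih hR
  | countableAnd _ φ ih => exact fun m => ih m (h.mono fun i hi => hi m)
  | Q ψ₀ ψ₁ ψ₂ ψ₃ ψ₄ =>
    refine TreeStructure.MemQuantifier.ultraproduct hdense htop hl
      (N := fun i => qTree ψ₀ ψ₁ ψ₂ ψ₃ ψ₄ (ρ i) fun j => x j i) (fun a b => ?_) (fun a b => ?_)
      (fun a b => ?_) (fun a => ?_) (fun a => ?_) h
    all_goals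
      simp only [qTree, ← hsnoc']
      rw [← RelAssignment.holds_ultraproduct]
      simp only [hsnoc]

theorem Logic.fullCompactnessTheorem_dLogic (c : Prop) {𝒜 : Set (Set (ℕ → Bool))}
    (hdense : ∀ B ∈ 𝒜, Dense B) (htop : ⋃₀ 𝒜 ∈ 𝒜) :
    (dLogic.{u} c 𝒜).FullCompactnessTheorem := by
  intro κ τ T _ hT
  have hmodel : ∀ i : Finset T × ℕ, ∃ (M : Type u) (_ : Nonempty M) (_ : τ.Structure M),
      ∀ φ ∈ i.1, (dLogic c 𝒜).Sat φ.1 M := by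
    intro i
    obtain ⟨M, hM, s, h⟩ := hT (Subtype.val '' (i.1 : Set T)) (by rintro _ ⟨φ, -, rfl⟩; exact φ.2)
      (Cardinal.lt_aleph0_iff_set_finite.2 (i.1.finite_toSet.image _))
    exact ⟨M, hM, s, fun φ hφ => h φ ⟨φ, hφ, rfl⟩⟩
  choose M hM s h using hmodel
  classical
  -- The factor `ℕ` provides the lengths that tend to infinity, whatever the size of `T`.
  let U : Ultrafilter (Finset T × ℕ) := Ultrafilter.of atTop
  have hU : (U : Filter (Finset T × ℕ)) ≤ atTop := Ultrafilter.of_le _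
  have hl : Tendsto (Prod.snd : Finset T × ℕ → ℕ) U atTop :=
    (tendsto_snd.mono_left prod_atTop_atTop_eq.ge).mono_left hU
  refine ⟨(U : Filter (Finset T × ℕ)).Product M, inferInstance, inferInstance, fun φ hφ => ?_⟩
  have key := PosFormula.Realize.ultraproduct (M := M) hdense htop hl (φ := φ)
    (ρ := fun i => RelAssignment.empty (M i)) (x := Fin.elim0) (by
      refine hU ((eventually_ge_atTop ({⟨φ, hφ⟩}, 0)).mono fun i hi => ?_)
      have := h i ⟨φ, hφ⟩ (hi.1 (Finset.mem_singleton_self _))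
      change PosFormula.Realize _ _ _ _
      rwa [Subsingleton.elim (fun j : Fin 0 => _) (default : Fin 0 → M i)])
  rwa [RelAssignment.eq_empty (RelAssignment.ultraproduct _),
    Subsingleton.elim (fun j : Fin 0 => _) default] at key

end Ultraproduct
/-! ## The Downward Löwenheim–Skolem Theorem -/

section LowenheimSkolem

open Filter FirstOrder.Language

variable {A : Set.Iio (ω₁ : Ordinal.{0}) → Set (ℕ → Bool)} {S : Set (Set.Iio (ω₁ : Ordinal.{0}))}

theorem TreeStructure.IsTreeLike.eventually_closedUnderSucc {M : Type u} {T : TreeStructure M}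
    (hT : T.IsTreeLike) {Y : Type*} :
    ∀ᶠ N in clubFilter (M ⊕ Y), T.ClosedUnderSucc (Sum.inl ⁻¹' N) := by
  obtain ⟨x₀, hx₀, -⟩ := hT.root
  have hsucc : ∀ b : Bool, ∀ᶠ N in clubFilter (M ⊕ Y), ∀ x, Sum.inl x ∈ N →
      ∀ y, T.bit b x y → Sum.inl y ∈ N := fun b => eventually_diagonal Sum.inl_injective fun x => by
    by_cases h : ∃ y, T.bit b x y
    · obtain ⟨y, hy⟩ := h
      refine (eventually_mem_clubFilter (Sum.inl y)).mono fun N hN z hz => ?_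
      rwa [hT.bit_unique hz hy]
    · exact .of_forall fun N y hy => absurd ⟨y, hy⟩ h
  filter_upwards [eventually_mem_clubFilter (Sum.inl x₀), eventually_countable_forall.2 hsucc]
    with N hN h
  exact ⟨fun x hx => by rwa [hT.root_unique x x₀ hx hx₀], h⟩

theorem TreeStructure.MemQuantifier.eventually_comap (hA : IsDenseChain A) {M : Type u}
    {T : TreeStructure M} (hT : T.MemQuantifier (chainFamily A S)) :
    ∀ᶠ N in clubFilter (M ⊕ Set.Iio (ω₁ : Ordinal.{0})),
      (∃ δ ∈ S, Sum.inr ⁻¹' N = Set.Iio δ) → ∀ {K : Type u} (f : K → M), Function.Injective f →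
        Set.range f = Sum.inl ⁻¹' N → (T.comap f).MemQuantifier (chainFamily A S) := by
  obtain ⟨hT, hmem⟩ := hT
  unfold MemQuantifier
  rw [IsDenseChain.sUnion_chainFamily] at hmem ⊢
  rcases hmem with htop | ⟨α, hα, hαe⟩
  · have hwit : ∀ η ∈ ⋃ α, A α, ∃ a, ∀ n, T.RepresentsUpTo a η n :=
      fun η hη => (htop.symm.subset hη).1
    have h₁ : ∀ᶠ N in clubFilter (M ⊕ Set.Iio (ω₁ : Ordinal.{0})), ∀ β, Sum.inr β ∈ N →
        ∀ η ∈ A β, ∃ a, Sum.inl a ∈ N ∧ ∀ n, T.RepresentsUpTo a η n :=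
      eventually_diagonal Sum.inr_injective fun β =>
        (eventually_countable_ball (hA.countable β)).2 fun η hη => by
          obtain ⟨a, ha⟩ := hwit η (Set.mem_iUnion.2 ⟨β, hη⟩)
          exact (eventually_mem_clubFilter (Sum.inl a)).mono fun N hN => ⟨a, hN, ha⟩
    -- An element represents at most one real, so a single index `β` has to be put into `N` on its
    -- behalf.
    have h₂ : ∀ᶠ N in clubFilter (M ⊕ Set.Iio (ω₁ : Ordinal.{0})), ∀ a, Sum.inl a ∈ N →
        ∀ η ∈ ⋃ α, A α, (∀ n, T.RepresentsUpTo a η n) → ∃ β, Sum.inr β ∈ N ∧ η ∈ A β :=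
      eventually_diagonal Sum.inl_injective fun a => by
        by_cases h : ∃ η ∈ ⋃ α, A α, ∀ n, T.RepresentsUpTo a η n
        · obtain ⟨η, hη, ha⟩ := h
          obtain ⟨β, hβ⟩ := Set.mem_iUnion.1 hη
          refine (eventually_mem_clubFilter (Sum.inr β)).mono fun N hN θ _ hθ => ⟨β, hN, ?_⟩
          rwa [hT.representsUpTo_unique hθ ha]
        · exact .of_forall fun N η hη hη' => absurd ⟨η, hη, hη'⟩ h
    have h₃ : ∀ᶠ N in clubFilter (M ⊕ Set.Iio (ω₁ : Ordinal.{0})), ∀ β, Sum.inr β ∈ N →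
        ∃ γ, Sum.inr γ ∈ N ∧ β < γ := eventually_diagonal Sum.inr_injective fun β => by
      obtain ⟨γ, hγ⟩ := exists_gt β
      exact (eventually_mem_clubFilter (Sum.inr γ)).mono fun N hN => ⟨γ, hN, hγ⟩
    filter_upwards [hT.eventually_closedUnderSucc, h₁, h₂, h₃,
      eventually_mem_clubFilter (Sum.inr (Classical.arbitrary _))] with N hN h₁ h₂ h₃ h₄
    rintro ⟨δ, hδS, hδ⟩ K f hf hrange
    rw [← hrange] at hN
    have hmem : ∀ β, Sum.inr β ∈ N ↔ β < δ := fun β => Set.ext_iff.1 hδ β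
    -- `N` contains an ordinal, and with each ordinal a larger one; so `δ` is a limit and `A δ` is
    -- the union of the earlier stages.
    have hlim : Order.IsSuccLimit δ := by
      refine ⟨fun hmin => hmin.not_lt ((hmem _).1 h₄), fun β hβ => ?_⟩
      obtain ⟨γ, hγ, hlt⟩ := h₃ β ((hmem β).2 hβ.lt)
      exact hβ.2 hlt ((hmem γ).1 hγ)
    refine ⟨hT.comap hf hN.root, Or.inr ⟨δ, hδS, ?_⟩⟩
    rw [omega_comap hN, hrange, hA.continuous δ hlim]
    ext η
    simp only [Set.mem_iUnion, exists_prop]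
    constructor
    · rintro ⟨β, hβ, hη⟩
      exact ⟨h₁ β ((hmem β).2 hβ) η hη, Set.mem_iUnion.2 ⟨β, hη⟩⟩
    · rintro ⟨⟨a, ha, haη⟩, hη⟩
      obtain ⟨β, hβ, hβη⟩ := h₂ a ha η hη haη
      exact ⟨β, (hmem β).1 hβ, hβη⟩
  -- Here the trace is the countable set `A α`: representing elements for all its members fit into
  -- `N`, and passing to a subset adds no new reals. The value of `δ` plays no role.
  · have hwit : ∀ᶠ N in clubFilter (M ⊕ Set.Iio (ω₁ : Ordinal.{0})), ∀ η ∈ A α,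
        ∃ a, Sum.inl a ∈ N ∧ ∀ n, T.RepresentsUpTo a η n :=
      (eventually_countable_ball (hA.countable α)).2 fun η hη => by
        obtain ⟨a, ha⟩ := (hαe.subset hη).1
        exact (eventually_mem_clubFilter (Sum.inl a)).mono fun N hN => ⟨a, hN, ha⟩
    filter_upwards [hT.eventually_closedUnderSucc, hwit] with N hN h₁
    rintro - K f hf hrange
    rw [← hrange] at hN
    refine ⟨hT.comap hf hN.root, Or.inr ⟨α, hα, ?_⟩⟩
    rw [omega_comap hN, hrange]
    ext η
    constructor
    · exact fun hη => ⟨h₁ η hη, Set.mem_iUnion.2 ⟨α, hη⟩⟩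
    · rintro ⟨⟨a, -, haη⟩, hη⟩
      exact hαe.symm.subset ⟨⟨a, haη⟩, hη⟩

/-! ### Reflection of formulas to countable substructures -/

instance countable_sigma_relVar (Γ : List ℕ) : Countable (Σ k, RelVar Γ k) := by
  induction Γ with
  | nil =>
    have : IsEmpty (Σ k, RelVar [] k) := ⟨fun x => nomatch x.2⟩
    infer_instance
  | cons m Γ ih =>
    have hsurj : Function.Surjective fun o : Option (Σ k, RelVar Γ k) =>
        (o.elim ⟨m, .head⟩ fun x => ⟨x.1, .tail x.2⟩ : Σ k, RelVar (m :: Γ) k) := by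
      rintro ⟨k, _ | r⟩
      · exact ⟨none, rfl⟩
      · exact ⟨some ⟨k, r⟩, rfl⟩
    exact hsurj.countable

theorem card_withRelVars_le {τ : FirstOrder.Language.{u, u}} (hτ : τ.card ≤ ℵ₀) (Γ : List ℕ) :
    (withRelVars τ Γ).card ≤ ℵ₀ := by
  have h : (relVarLanguage Γ).card ≤ ℵ₀ := by
    have : Countable (relVarLanguage Γ).Symbols := by
      have h₁ : IsEmpty (Σ k, (relVarLanguage Γ).Functions k) := ⟨fun x => nomatch x.2⟩
      have h₂ : Countable (Σ k, (relVarLanguage Γ).Relations k) := countable_sigma_relVar Γ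
      exact inferInstanceAs (Countable (_ ⊕ _))
    exact Cardinal.mk_le_aleph0_iff.2 this
  rw [Language.card_sum]
  exact Cardinal.add_le_aleph0.2 ⟨by simpa using hτ, by simpa using h⟩

variable {τ : FirstOrder.Language.{u, u}} {M : Type u} [τ.Structure M] {Γ : List ℕ}

/-- There are countably many first order formulas, and `N` is closed under one choice of witness for
each formula and each tuple of parameters. -/
theorem RelAssignment.eventually_holds_comap (hτ : τ.card ≤ ℵ₀) (ρ : RelAssignment Γ M)
    (Y : Type*) : ∀ᶠ N in clubFilter (M ⊕ Y), ∀ K : τ.Substructure M, (K : Set M) = Sum.inl ⁻¹' N →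
      ∀ {n : ℕ} (φ : (withRelVars τ Γ).BoundedFormula Empty n) (ys : Fin n → K),
        (ρ.comap Subtype.val).Holds φ ys ↔ ρ.Holds φ (Subtype.val ∘ ys) := by
  have hc : Countable (Σ n, (withRelVars τ Γ).BoundedFormula Empty n) :=
    Cardinal.mk_le_aleph0_iff.1 (BoundedFormula.card_le.trans (by
      simpa using card_withRelVars_le hτ Γ))
  have hn : ∀ n, Countable ((withRelVars τ Γ).BoundedFormula Empty n) := fun n =>
    (sigma_mk_injective (β := fun n => (withRelVars τ Γ).BoundedFormula Empty n)
      (i := n)).countable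
  have key : ∀ n, ∀ φ : (withRelVars τ Γ).BoundedFormula Empty (n + 1),
      ∀ᶠ N in clubFilter (M ⊕ Y), ∀ x : Fin n → M, (∀ i, Sum.inl (x i) ∈ N) →
        (∃ a, ρ.Holds φ (Fin.snoc x a : _ → M)) →
          ∃ b, Sum.inl b ∈ N ∧ ρ.Holds φ (Fin.snoc x b : _ → M) :=
    fun n φ => eventually_diagonal_fin Sum.inl_injective fun x => by
      by_cases h : ∃ a, ρ.Holds φ (Fin.snoc x a : _ → M)
      · obtain ⟨a, ha⟩ := h
        exact (eventually_mem_clubFilter (Sum.inl a)).mono fun N hN _ => ⟨a, hN, ha⟩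
      · exact .of_forall fun N h' => absurd h' h
  filter_upwards [eventually_countable_forall.2 fun n => eventually_countable_forall.2 (key n)]
    with N hN K hK n φ ys
  have hmem : ∀ m, m ∈ K ↔ Sum.inl m ∈ N := fun m => Set.ext_iff.1 hK m
  refine ρ.holds_comap_of_exists K.subtype (fun n φ x a ha => ?_) φ ys
  obtain ⟨b, hb, hφ⟩ := hN n φ _ (fun i => (hmem _).1 (x i).2) ⟨a, ha⟩
  exact ⟨⟨b, (hmem b).2 hb⟩, hφ⟩

/-- Induction on the formula: countable conjunctions use countable intersections in the club filter,
universal quantifiers use diagonal intersections, and existentially quantified relations are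
restricted to the substructure. -/
theorem PosFormula.Realize.eventually_comap (hA : IsDenseChain A) (hτ : τ.card ≤ ℵ₀) {c : Prop}
    {n : ℕ} {φ : PosFormula c τ Γ n} {ρ : RelAssignment Γ M} {xs : Fin n → M}
    (h : φ.Realize (chainFamily A S) ρ xs) :
    ∀ᶠ N in clubFilter (M ⊕ Set.Iio (ω₁ : Ordinal.{0})),
      (∃ δ ∈ S, Sum.inr ⁻¹' N = Set.Iio δ) → ∀ K : τ.Substructure M, (K : Set M) = Sum.inl ⁻¹' N →
        ∀ ys : Fin n → K, Subtype.val ∘ ys = xs →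
          φ.Realize (chainFamily A S) (ρ.comap Subtype.val) ys := by
  induction φ with
  | fo φ =>
    filter_upwards [ρ.eventually_holds_comap hτ _] with N hN _ K hK ys hys
    exact (hN K hK φ ys).2 (hys ▸ h)
  | and φ ψ ih₁ ih₂ =>
    filter_upwards [ih₁ h.1, ih₂ h.2] with N h₁ h₂ hδ K hK ys hys
    exact ⟨h₁ hδ K hK ys hys, h₂ hδ K hK ys hys⟩
  | or φ ψ ih₁ ih₂ =>
    rcases h with h | h
    · filter_upwards [ih₁ h] with N h₁ hδ K hK ys hys
      exact Or.inl (h₁ hδ K hK ys hys)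
    · filter_upwards [ih₂ h] with N h₂ hδ K hK ys hys
      exact Or.inr (h₂ hδ K hK ys hys)
  | ex φ ih =>
    obtain ⟨a, ha⟩ := h
    filter_upwards [ih ha, eventually_mem_clubFilter (Sum.inl a)] with N hN haN hδ K hK ys hys
    have haK : a ∈ K := (Set.ext_iff.1 hK a).2 haN
    exact ⟨⟨a, haK⟩, hN hδ K hK _ (by rw [Fin.comp_snoc, hys])⟩
  | all φ ih =>
    filter_upwards [eventually_diagonal Sum.inl_injective fun a => ih (h a)] with N hN hδ K hK ys hys
    exact fun b => hN b ((Set.ext_iff.1 hK b).1 b.2) hδ K hK _ (by rw [Fin.comp_snoc, hys])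
  | exRel k φ ih =>
    obtain ⟨R, hR⟩ := h
    filter_upwards [ih hR] with N hN hδ K hK ys hys
    refine ⟨fun zs => R (Subtype.val ∘ zs), ?_⟩
    rw [← RelAssignment.comap_cons]
    exact hN hδ K hK ys hys
  | countableAnd _ φ ih =>
    filter_upwards [eventually_countable_forall.2 fun i => ih i (h i)] with N hN hδ K hK ys hys
    exact fun i => hN i hδ K hK ys hys
  | Q ψ₀ ψ₁ ψ₂ ψ₃ ψ₄ =>
    filter_upwards [ρ.eventually_holds_comap hτ _,
      TreeStructure.MemQuantifier.eventually_comap hA (realize_Q.1 h)] with N hN hQ hδ K hK ys hys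
    rw [realize_Q, qTree_comap (hN K hK), hys]
    exact hQ hδ _ Subtype.val_injective (by rw [Subtype.range_coe_subtype]; exact hK)

theorem Logic.downwardLowenheimSkolem_dLogic (c : Prop) (hA : IsDenseChain A)
    (hS : IsStationary S) : (dLogic.{u} c (chainFamily A S)).DownwardLowenheimSkolem := by
  rintro τ hτ φ ⟨M, ⟨m₀⟩, _, h⟩
  have hcF : Countable (Σ n, τ.Functions n) := by
    have : Countable ((Σ n, τ.Functions n) ⊕ Σ n, τ.Relations n) := Cardinal.mk_le_aleph0_iff.1 hτ
    exact Sum.inl_injective (β := Σ n, τ.Relations n) |>.countable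
  have hfun : ∀ g : Σ n, τ.Functions n, ∀ᶠ N in clubFilter (M ⊕ Set.Iio (ω₁ : Ordinal.{0})),
      ∀ x : Fin g.1 → M, (∀ i, Sum.inl (x i) ∈ N) → Sum.inl (Structure.funMap g.2 x) ∈ N :=
    fun g => eventually_diagonal_fin Sum.inl_injective fun x => eventually_mem_clubFilter _
  obtain ⟨N, hN, hδ, hm₀, hfun, hφ⟩ := hS.exists_of_eventually
    ((eventually_mem_clubFilter (Sum.inl m₀)).and ((eventually_countable_forall.2 hfun).and
      (PosFormula.Realize.eventually_comap hA hτ h)))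
  let K : τ.Substructure M := ⟨Sum.inl ⁻¹' N, fun {n} f x hx => hfun ⟨n, f⟩ x hx⟩
  refine ⟨K, ⟨⟨m₀, hm₀⟩⟩, inferInstance, (hN.preimage Sum.inl_injective).to_subtype, ?_⟩
  have := hφ hδ K rfl default (Subsingleton.elim _ _)
  rwa [RelAssignment.eq_empty (RelAssignment.comap _ _)] at this

end LowenheimSkolem
/-! ## The vocabulary of tree structures -/

/-- The arities of the relations `R₀, …, R₄` of a tree structure. -/
abbrev treeArities : List ℕ := [2, 2, 2, 1, 1]

/-- The vocabulary of tree structures. -/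
def treeLanguage : FirstOrder.Language.{u, u} where
  Functions _ := PEmpty
  Relations k := ULift (RelVar treeArities k)

theorem card_treeLanguage_le : treeLanguage.{u}.card ≤ ℵ₀ := by
  have : Countable treeLanguage.{u}.Symbols := by
    have h₁ : IsEmpty (Σ k, treeLanguage.{u}.Functions k) := ⟨fun x => nomatch x.2⟩
    have h₂ : Countable (Σ k, treeLanguage.{u}.Relations k) := by
      refine Function.Injective.countable (β := Σ k, RelVar treeArities k)
        (f := fun x => ⟨x.1, x.2.down⟩) ?_
      rintro ⟨k, ⟨r⟩⟩ ⟨k', ⟨r'⟩⟩ h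
      cases h
      rfl
    exact inferInstanceAs (Countable (_ ⊕ _))
  exact Cardinal.mk_le_aleph0_iff.2 this

namespace TreeStructure

/-- A tree structure as a structure for the vocabulary of tree structures. -/
@[reducible]
def toStructure {M : Type u} (T : TreeStructure M) : treeLanguage.{u}.Structure M where
  funMap f _ := nomatch f
  RelMap {_} r := match r.down with
    | .head => fun v => T.R₀ (v 0) (v 1)
    | .tail .head => fun v => T.R₁ (v 0) (v 1)
    | .tail (.tail .head) => fun v => T.R₂ (v 0) (v 1)
    | .tail (.tail (.tail .head)) => fun v => T.R₃ (v 0)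
    | .tail (.tail (.tail (.tail .head))) => fun v => T.R₄ (v 0)

/-- The tree structure that is given by a structure for the vocabulary of tree structures. -/
def ofStructure (M : Type u) [treeLanguage.{u}.Structure M] : TreeStructure M where
  R₀ a b := FirstOrder.Language.Structure.RelMap (L := treeLanguage.{u}) (n := 2)
    ⟨.head⟩ (Fin.snoc (Fin.snoc default a : Fin 1 → M) b)
  R₁ a b := FirstOrder.Language.Structure.RelMap (L := treeLanguage.{u}) (n := 2)
    ⟨.tail .head⟩ (Fin.snoc (Fin.snoc default a : Fin 1 → M) b)
  R₂ a b := FirstOrder.Language.Structure.RelMap (L := treeLanguage.{u}) (n := 2)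
    ⟨.tail (.tail .head)⟩ (Fin.snoc (Fin.snoc default a : Fin 1 → M) b)
  R₃ a := FirstOrder.Language.Structure.RelMap (L := treeLanguage.{u}) (n := 1)
    ⟨.tail (.tail (.tail .head))⟩ (Fin.snoc default a : Fin 1 → M)
  R₄ a := FirstOrder.Language.Structure.RelMap (L := treeLanguage.{u}) (n := 1)
    ⟨.tail (.tail (.tail (.tail .head)))⟩ (Fin.snoc default a : Fin 1 → M)

end TreeStructure

/-- The atomic formula `R(x₀, …, xₖ₋₁)` for one of the relations of a tree structure. -/
def treeAtom {k : ℕ} (r : RelVar treeArities k) :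
    (withRelVars treeLanguage.{u} []).BoundedFormula Empty k :=
  .rel (Sum.inl ⟨r⟩) fun i => .var (Sum.inr i)

/-- The sentence `Q x₀ x₁ (R₀, R₁, R₂, R₃, R₄)`. -/
def treeSentence (c : Prop) : PosFormula c treeLanguage.{u} [] 0 :=
  .Q (n := 0) (treeAtom .head) (treeAtom (.tail .head)) (treeAtom (.tail (.tail .head)))
    (treeAtom (.tail (.tail (.tail .head)))) (treeAtom (.tail (.tail (.tail (.tail .head)))))

namespace Logic

theorem sat_treeSentence (c : Prop) (𝒜 : Set (Set (ℕ → Bool))) (M : Type u)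
    [treeLanguage.{u}.Structure M] : (dLogic c 𝒜).Sat (treeSentence c) M ↔
      (TreeStructure.ofStructure M).MemQuantifier 𝒜 :=
  Iff.rfl

variable {A : Set.Iio (ω₁ : Ordinal.{0}) → Set (ℕ → Bool)}
  {S S' : Set (Set.Iio (ω₁ : Ordinal.{0}))}

/-! ### Absence of a common extension, and its consequences -/

theorem not_exists_common_extension (c : Prop) (hA : IsDenseChain A) (hS : Disjoint S S') :
    ¬ ∃ L : Logic.{u, w}, L.IsAbstract ∧ (dLogic.{u} c (chainFamily A S)).Sublogic L ∧
      (dLogic.{u} c (chainFamily A S')).Sublogic L ∧ L.DownwardLowenheimSkolem := by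
  rintro ⟨L, hL, h, h', hLS⟩
  obtain ⟨ψ, hψ⟩ := h (treeSentence c)
  obtain ⟨ψ', hψ'⟩ := h' (treeSentence c)
  obtain ⟨χ, hχ⟩ := hL.conj ψ ψ'
  have hsat : ∀ (M : Type u) [Nonempty M] [treeLanguage.{u}.Structure M], L.Sat χ M ↔
      (TreeStructure.ofStructure M).MemQuantifier (chainFamily A S) ∧
        (TreeStructure.ofStructure M).MemQuantifier (chainFamily A S') := fun M _ _ => by
    rw [hχ, ← hψ, ← hψ', sat_treeSentence, sat_treeSentence]
  obtain ⟨M, _, _, hM, hMχ⟩ := hLS card_treeLanguage_le χ (by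
    -- The trace of this tree on `A_{ω₁}` is all of `A_{ω₁}`, which belongs to both families.
    let T := TreeStructure.ofBranches.{u} (⋃ α, A α)
    let s := T.toStructure
    refine ⟨_, ⟨⟨.inl []⟩⟩, s, (hsat _).2 ?_⟩
    have hT : ∀ S, T.MemQuantifier (chainFamily A S) := fun S => by
      refine ⟨TreeStructure.isTreeLike_ofBranches _, ?_⟩
      rw [IsDenseChain.sUnion_chainFamily,
        Set.inter_eq_right.2 (TreeStructure.subset_omega_ofBranches _)]
      exact Set.mem_insert _ _
    exact ⟨hT S, hT S'⟩)
  obtain ⟨⟨htree, h₁⟩, -, h₂⟩ := (hsat M).1 hMχ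
  rw [IsDenseChain.sUnion_chainFamily] at h₁ h₂
  have := hA.eq_iUnion_of_mem_of_mem hS h₁ h₂
  exact hA.not_countable_iUnion (this ▸ htree.countable_omega.mono Set.inter_subset_left)

/-- If the logic for `S` were contained in `B`, the logic for `S'` would contain both and still
satisfy Löwenheim–Skolem. -/
theorem properSublogic_dLogic {c : Prop} {B : Logic.{u, u}} (hA : IsDenseChain A)
    (hS : Disjoint S S') (hS' : IsStationary S')
    (hB : ∀ 𝒜, B.Sublogic (dLogic.{u} c 𝒜)) : B.ProperSublogic (dLogic.{u} c (chainFamily A S)) :=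
  ⟨hB _, fun h => not_exists_common_extension c hA hS ⟨dLogic c (chainFamily A S'),
    (isPositive_dLogic c _).toIsAbstract, h.trans (hB _), fun φ => ⟨φ, fun _ _ _ => Iff.rfl⟩,
    downwardLowenheimSkolem_dLogic c hA hS'⟩⟩

theorem fullCompactnessTheorem_chainFamily (c : Prop) (hA : IsDenseChain A) :
    (dLogic.{u} c (chainFamily A S)).FullCompactnessTheorem :=
  fullCompactnessTheorem_dLogic c (fun _ => hA.dense_of_mem)
    (by rw [IsDenseChain.sUnion_chainFamily]; exact Set.mem_insert _ _)

/-- A strongest logic would contain the logics for both stationary sets. The version with countable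
conjunctions can be used for all three base logics, since it contains each of them. -/
theorem not_exists_isStrongestExtension {B : Logic.{u, u}}
    (hB : ∀ 𝒜, B.Sublogic (dLogic.{u} True 𝒜)) :
    ¬ ∃ L : Logic.{u, w}, IsStrongestExtension.{u, w} B L := by
  rintro ⟨L, hL⟩
  obtain ⟨S, S', hS, hS', hd⟩ := exists_disjoint_isStationary
  obtain ⟨A, hA⟩ := exists_isDenseChain
  have key : ∀ S, IsStationary S → (dLogic.{u} True (chainFamily A S)).Sublogic L := fun S hS =>
    hL.strongest _ (isPositive_dLogic True _) (hB _)
      (fullCompactnessTheorem_chainFamily True hA ℵ₀) (downwardLowenheimSkolem_dLogic True hA hS)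
  exact not_exists_common_extension True hA hd
    ⟨L, hL.positive.toIsAbstract, key S hS, key S' hS', hL.lowenheimSkolem⟩

end Logic

theorem mainTheorem1 :
    -- there are two disjoint stationary subsets of `ω₁`, and a chain as required
    (∃ S S' : Set (Set.Iio (ω₁ : Ordinal.{0})),
      IsStationary S ∧ IsStationary S' ∧ Disjoint S S') ∧
    (∃ A : Set.Iio (ω₁ : Ordinal.{0}) → Set (ℕ → Bool), IsDenseChain A) ∧
    -- any such data yield the two logics
    (∀ (S S' : Set (Set.Iio (ω₁ : Ordinal.{0})))
      (A : Set.Iio (ω₁ : Ordinal.{0}) → Set (ℕ → Bool)),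
      IsStationary S → IsStationary S' → Disjoint S S' → IsDenseChain A →
      -- the version for `Σ¹₁`
      (∀ L₁ L₂ : Logic.{u, u},
        L₁ = Logic.dMinus (chainFamily A S) → L₂ = Logic.dMinus (chainFamily A S') →
        (L₁.IsPositive ∧ L₂.IsPositive) ∧
        (Logic.sigma11.ProperSublogic L₁ ∧ Logic.sigma11.ProperSublogic L₂) ∧
        (L₁.FullCompactnessTheorem ∧ L₁.DownwardLowenheimSkolem) ∧
        (L₂.FullCompactnessTheorem ∧ L₂.DownwardLowenheimSkolem) ∧
        ¬ ∃ L₃ : Logic.{u, w}, L₃.IsAbstract ∧ L₁.Sublogic L₃ ∧ L₂.Sublogic L₃ ∧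
          L₃.DownwardLowenheimSkolem) ∧
      -- the version for `Σ¹₁,δ`
      (∀ L₁ L₂ : Logic.{u, u},
        L₁ = Logic.dMinusOmega (chainFamily A S) → L₂ = Logic.dMinusOmega (chainFamily A S') →
        (L₁.IsPositive ∧ L₂.IsPositive) ∧
        (Logic.sigma11Delta.ProperSublogic L₁ ∧ Logic.sigma11Delta.ProperSublogic L₂) ∧
        (L₁.FullCompactnessTheorem ∧ L₁.DownwardLowenheimSkolem) ∧
        (L₂.FullCompactnessTheorem ∧ L₂.DownwardLowenheimSkolem) ∧
        ¬ ∃ L₃ : Logic.{u, w}, L₃.IsAbstract ∧ L₁.Sublogic L₃ ∧ L₂.Sublogic L₃ ∧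
          L₃.DownwardLowenheimSkolem)) ∧
    -- no positive logic is a strongest extension of first order logic, of `Σ¹₁`, or of `Σ¹₁,δ`
    (¬ ∃ L : Logic.{u, w}, Logic.IsStrongestExtension.{u, w} Logic.firstOrder L) ∧
    (¬ ∃ L : Logic.{u, w}, Logic.IsStrongestExtension.{u, w} Logic.sigma11 L) ∧
    (¬ ∃ L : Logic.{u, w}, Logic.IsStrongestExtension.{u, w} Logic.sigma11Delta L) := by
  refine ⟨exists_disjoint_isStationary, exists_isDenseChain, ?_,
    Logic.not_exists_isStrongestExtension (Logic.firstOrder_sublogic_dLogic True),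
    Logic.not_exists_isStrongestExtension (Logic.sigma11_sublogic_dLogic True),
    Logic.not_exists_isStrongestExtension Logic.sigma11Delta_sublogic_dLogic⟩
  have key : ∀ (c : Prop) (B : Logic.{u, u}), (∀ 𝒜, B.Sublogic (Logic.dLogic.{u} c 𝒜)) →
      ∀ (S S' : Set (Set.Iio (ω₁ : Ordinal.{0})))
        (A : Set.Iio (ω₁ : Ordinal.{0}) → Set (ℕ → Bool)),
        IsStationary S → IsStationary S' → Disjoint S S' → IsDenseChain A →
        ∀ L₁ L₂ : Logic.{u, u}, L₁ = Logic.dLogic c (chainFamily A S) →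
          L₂ = Logic.dLogic c (chainFamily A S') →
        (L₁.IsPositive ∧ L₂.IsPositive) ∧
        (B.ProperSublogic L₁ ∧ B.ProperSublogic L₂) ∧
        (L₁.FullCompactnessTheorem ∧ L₁.DownwardLowenheimSkolem) ∧
        (L₂.FullCompactnessTheorem ∧ L₂.DownwardLowenheimSkolem) ∧
        ¬ ∃ L₃ : Logic.{u, w}, L₃.IsAbstract ∧ L₁.Sublogic L₃ ∧ L₂.Sublogic L₃ ∧
          L₃.DownwardLowenheimSkolem := by
    rintro c B hB S S' A hS hS' hd hA _ _ rfl rfl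
    exact ⟨⟨Logic.isPositive_dLogic c _, Logic.isPositive_dLogic c _⟩,
      ⟨Logic.properSublogic_dLogic hA hd hS' hB, Logic.properSublogic_dLogic hA hd.symm hS hB⟩,
      ⟨Logic.fullCompactnessTheorem_chainFamily c hA,
        Logic.downwardLowenheimSkolem_dLogic c hA hS⟩,
      ⟨Logic.fullCompactnessTheorem_chainFamily c hA,
        Logic.downwardLowenheimSkolem_dLogic c hA hS'⟩,
      Logic.not_exists_common_extension c hA hd⟩
  exact fun S S' A hS hS' hd hA =>
    ⟨key False _ (Logic.sigma11_sublogic_dLogic False) S S' A hS hS' hd hA,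
      key True _ Logic.sigma11Delta_sublogic_dLogic S S' A hS hS' hd hA⟩
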